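/- Let $\exp_2(z)=e^z-1-z$, and let $Q(z)=\dfrac{z(e^z-1)}{e^z-1-z}$ for real $z\neq 0$, with $Q(0)=2$; $Q$ is continuous and strictly increasing on $\mathbb R$, and $Q^{-1}$ denotes its inverse. For an integer $K\ge 3$, $c>2$, $\alpha\in[0,1]$ and $\zeta=(\zeta_1,\zeta_2)\in\mathbb R_{>0}^2$ put $$J_K(\alpha,\zeta;c)=\frac1K H(\alpha)+\alpha\ln\frac{\alpha}{\zeta_1}+(1-\alpha)\ln\frac{1-\alpha}{\zeta_2}+\frac1c\ln\frac{\exp_2(\lambda(\zeta_2+\zeta_1))+\exp_2(\lambda(\zeta_2-\zeta_1))}{2\exp_2(\lambda)},$$ where $\lambda=Q^{-1}(c)$, $H(\alpha)=-\alpha\ln\alpha-(1-\alpha)\ln(1-\alpha)$ and $0\ln 0=0$. Let $$\beta_K=\exp\left(-\left(\frac1K+\ln\sqrt{K-1}-1+\frac{K}{2(K-1)}\right)\Big/\left(\frac12-\frac1K\right)\right).$$ **Proposition.** For every integer $K\ge 3$ there exist positive continuous functions $\epsilon_K$ and $\underline\zeta_K$ of $c\in(2,K)$ and, for each $c\in(2,K)$,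 a piecewise continuous function $\zeta_{K,c}=(\zeta_1,\zeta_2)\colon[0,1]\to\mathbb R_{>0}^2$ with $\zeta_2(\alpha)\ge\underline\zeta_K(c)$ for all $\alpha\in[0,1]$, such that for all $c\in(2,K)$ $$J_K(\alpha,\zeta_{K,c}(\alpha);c)\le\left(\frac12-\frac1K\right)\alpha\ln(\alpha/\beta_K)\quad\text{for all }\alpha\in(0,\,0.99\beta_K),$$ $$J_K(\alpha,\zeta_{K,c}(\alpha);c)\le-\epsilon_K(c)\quad\text{for all }\alpha\in[\beta_K/2,\,1].$$ Here piecewise continuous means: continuous except at finitely many points of $[0,1]$, with finite one-sided limits everywhere. -/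

import Mathlib

open Set Filter Topology

noncomputable section

namespace XorGame

/-- The truncated exponential `exp₂(z) = e^z - 1 - z`. -/
def expTwo (z : ℝ) : ℝ := Real.exp z - 1 - z

/-- `Q(z) = z (e^z - 1) / (e^z - 1 - z)`, extended by continuity to `Q(0) = 2`. It is a continuous
strictly increasing function on the reals. -/
def Q (z : ℝ) : ℝ := if z = 0 then 2 else z * (Real.exp z - 1) / expTwo z

/-- The inverse function of `Q` (only used at values `c > 2`, which lie in the range of `Q`). -/
def QInv (c : ℝ) : ℝ := Function.invFun Q c

/-- The entropy function `H(α) = -α ln α - (1 - α) ln (1 - α)`, with `0 ln 0 = 0`. -/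
def H (α : ℝ) : ℝ := -α * Real.log α - (1 - α) * Real.log (1 - α)

/-- The function `J_K(α, ζ; c)` for `c > 2`, `α ∈ [0, 1]`, `ζ = (ζ₁, ζ₂)` with `ζ₁, ζ₂ > 0`. -/
def J (K : ℕ) (α : ℝ) (ζ : ℝ × ℝ) (c : ℝ) : ℝ :=
  1 / (K : ℝ) * H α + α * Real.log (α / ζ.1) + (1 - α) * Real.log ((1 - α) / ζ.2)
    + 1 / c * Real.log ((expTwo (QInv c * (ζ.2 + ζ.1)) + expTwo (QInv c * (ζ.2 - ζ.1)))
        / (2 * expTwo (QInv c)))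

/-- The constant `β_K`. -/
def beta (K : ℕ) : ℝ :=
  Real.exp (-(1 / (K : ℝ) + Real.log (Real.sqrt ((K : ℝ) - 1)) - 1
      + (K : ℝ) / (2 * ((K : ℝ) - 1))) / (1 / 2 - 1 / (K : ℝ)))

/-- `f` is piecewise continuous on `[a, b]`: it is continuous on `[a, b]` except at finitely many
points, and it has a finite one-sided limit at every point from each side that meets `[a, b]`. -/
def PiecewiseContinuousOn (f : ℝ → ℝ × ℝ) (a b : ℝ) : Prop :=
  (∃ F : Finset ℝ, ∀ x ∈ Icc a b, x ∉ F → ContinuousWithinAt f (Icc a b) x) ∧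
  (∀ x ∈ Ico a b, ∃ l : ℝ × ℝ, Tendsto f (𝓝[>] x) (𝓝 l)) ∧
  (∀ x ∈ Ioc a b, ∃ l : ℝ × ℝ, Tendsto f (𝓝[<] x) (𝓝 l))

end XorGame

end

namespace XorGame

/-! When `ζ₂ > ζ₁ > 0`, the logarithmic term of `J` increases with `c` (`log_expTwo_mean_mono`),
because the elasticity `z Q'(z) / Q(z)` is increasing. The explicit estimates may therefore be made
at `c = K`.

For small `α` take `ζ = (√(α/(K-1)), 1)`. Bernoulli's inequality and a quartic bound on `log cosh`
control the logarithmic term, and the terms of order `α log α` and `α` add up to `(1/2 - 1/K) α log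
(α/β_K)`. The excess of order `α²` is absorbed by the quartic gain together with the slack in `1 + λ
- λ/K ≤ K`, where `λ = Q⁻¹(K)` (`J_small_le`, `J_sqrt_le`).

For `0.99 β_K ≤ α < 1/2` write `α = (1-x)/2` and take `ζ = ((1-y)/2, (1+y)/2)`, with `y = x` if `K ≥
4` and `y = 3x/4` if `K = 3`. Then `J < 0` compares an entropy deficit with `log (1 +
exp₂(λy)/exp₂(λ))` (`mul_J_center_le`). At `α = 1/2` negativity comes from `c < K`; beyond it the
coordinates of `ζ` are swapped, and `α = 1` is treated separately.

So every `α` in `(0, 1]` has some `ζ` with `J < 0`. Joint continuity in `(α, c)` and compactness of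
`[β_K/2, 1]` yield a piecewise constant choice with a uniform bound, valid for all parameters near
`c`. The admissible bounds at each `c` form an interval, so a partition of unity makes the bound
continuous in `c`. -/

/-! ### Calculus of `exp₂` and `Q` on the positive axis. -/

theorem nonneg_of_hasDerivAt_nonneg {f f' : ℝ → ℝ} {x : ℝ} (hx : 0 ≤ x)
    (hf : ∀ t ∈ Icc 0 x, HasDerivAt f (f' t) t) (hf' : ∀ t ∈ Ioo 0 x, 0 ≤ f' t) (h0 : 0 ≤ f 0) :
    0 ≤ f x := by
  have hm : MonotoneOn f (Icc 0 x) := by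
    refine monotoneOn_of_deriv_nonneg (convex_Icc 0 x)
      (fun t ht => (hf t ht).continuousAt.continuousWithinAt)
      (fun t ht => (hf t (interior_subset ht)).differentiableAt.differentiableWithinAt) ?_
    intro t ht
    rw [(hf t (interior_subset ht)).deriv]
    rw [interior_Icc] at ht
    exact hf' t ht
  exact h0.trans (hm (left_mem_Icc.2 hx) (right_mem_Icc.2 hx) hx)

theorem expTwo_pos {z : ℝ} (hz : z ≠ 0) : 0 < expTwo z := by
  have := Real.add_one_lt_exp hz
  unfold expTwo; linarith

theorem expTwo_zero : expTwo 0 = 0 := by simp [expTwo]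

theorem expTwo_nonneg (z : ℝ) : 0 ≤ expTwo z := by
  have := Real.add_one_le_exp z
  unfold expTwo; linarith

theorem hasDerivAt_expTwo (z : ℝ) : HasDerivAt expTwo (Real.exp z - 1) z := by
  have := ((Real.hasDerivAt_exp z).sub_const 1).sub (hasDerivAt_id z)
  exact this

theorem continuous_expTwo : Continuous expTwo := by
  unfold expTwo; fun_prop

theorem exp_sub_one_pos {z : ℝ} (hz : 0 < z) : 0 < Real.exp z - 1 := by
  have := Real.add_one_lt_exp hz.ne'
  linarith

theorem Q_of_pos {z : ℝ} (hz : 0 < z) : Q z = z * (Real.exp z - 1) / expTwo z := by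
  simp [Q, hz.ne']

theorem Q_pos {z : ℝ} (hz : 0 < z) : 0 < Q z := by
  rw [Q_of_pos hz]
  exact div_pos (mul_pos hz (exp_sub_one_pos hz)) (expTwo_pos hz.ne')

theorem Q_eq_add {z : ℝ} (hz : 0 < z) : Q z = z + z ^ 2 / expTwo z := by
  have h := (expTwo_pos hz.ne').ne'
  rw [Q_of_pos hz]
  field_simp
  unfold expTwo; ring

/-- The logarithmic derivative `z Q'(z) / Q(z)`. -/
noncomputable def elast (z : ℝ) : ℝ := 1 + z / (Real.exp z - 1) - z ^ 2 / expTwo z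

theorem hasDerivAt_Q {z : ℝ} (hz : 0 < z) : HasDerivAt Q (elast z * Q z / z) z := by
  have h2 := (expTwo_pos hz.ne').ne'
  have h1 := (exp_sub_one_pos hz).ne'
  have key : HasDerivAt (fun z => z * (Real.exp z - 1) / expTwo z) (elast z * Q z / z) z := by
    have := ((hasDerivAt_id z).mul ((Real.hasDerivAt_exp z).sub_const 1)).div
      (hasDerivAt_expTwo z) h2
    refine this.congr_deriv ?_
    rw [Q_of_pos hz]
    simp only [id, elast, Pi.mul_apply]
    field_simp
    unfold expTwo; ring
  refine key.congr_of_eventuallyEq ?_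
  filter_upwards [eventually_ne_nhds hz.ne'] with y hy
  simp [Q, hy]

theorem hasDerivAt_log_expTwo {z : ℝ} (hz : 0 < z) :
    HasDerivAt (fun z => Real.log (expTwo z)) (Q z / z) z := by
  have h2 := (expTwo_pos hz.ne').ne'
  refine ((hasDerivAt_expTwo z).log h2).congr_deriv ?_
  rw [Q_of_pos hz]
  field_simp

theorem exp_sub_one_eq (z : ℝ) :
    Real.exp z - 1 = 2 * Real.sinh (z / 2) * Real.exp (z / 2) := by
  have h1 : Real.exp z = Real.exp (z / 2) * Real.exp (z / 2) := by
    rw [← Real.exp_add]; ring_nf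
  have h2 : Real.exp (z / 2) * Real.exp (-(z / 2)) = 1 := by
    rw [← Real.exp_add]; simp
  rw [Real.sinh_eq, h1]
  linear_combination h2

/-- Over a common denominator the numerator is `(e^z - 1)² - z² e^z`, which is positive because `2
sinh (z/2) > z`. -/
theorem elast_pos {z : ℝ} (hz : 0 < z) : 0 < elast z := by
  have h2 := expTwo_pos hz.ne'
  have h1 := exp_sub_one_pos hz
  have hE : Real.exp z = Real.exp (z / 2) ^ 2 := by
    rw [← Real.exp_nat_mul]; push_cast; ring_nf
  have key : 0 < (Real.exp z - 1) ^ 2 - z ^ 2 * Real.exp z := by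
    have hs : z / 2 < Real.sinh (z / 2) := Real.self_lt_sinh_iff.2 (by positivity)
    have hX := Real.exp_pos (z / 2)
    have hs2 : z ^ 2 < (2 * Real.sinh (z / 2)) ^ 2 := by
      apply pow_lt_pow_left₀ _ hz.le (by norm_num); linarith
    rw [exp_sub_one_eq, hE]
    have := mul_pos (sub_pos.2 hs2) (pow_pos hX 2)
    nlinarith
  have : elast z = ((Real.exp z - 1) ^ 2 - z ^ 2 * Real.exp z) / ((Real.exp z - 1) * expTwo z) := by
    unfold elast
    field_simp
    unfold expTwo; ring
  rw [this]
  positivity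

theorem strictMonoOn_Q : StrictMonoOn Q (Ioi 0) := by
  refine strictMonoOn_of_deriv_pos (convex_Ioi 0)
    (fun z hz => (hasDerivAt_Q hz).continuousAt.continuousWithinAt) ?_
  intro z hz
  rw [interior_Ioi] at hz
  rw [(hasDerivAt_Q hz).deriv]
  exact div_pos (mul_pos (elast_pos hz) (Q_pos hz)) hz

/-! ### Monotonicity of the logarithmic term in the parameter. -/

theorem sinh_le_mul_cosh {h : ℝ} (hh : 0 ≤ h) : Real.sinh h ≤ h * Real.cosh h := by
  have := nonneg_of_hasDerivAt_nonneg (f := fun t => t * Real.cosh t - Real.sinh t)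
    (f' := fun t => t * Real.sinh t) hh
    (fun t _ => (((hasDerivAt_id t).mul (Real.hasDerivAt_cosh t)).sub
      (Real.hasDerivAt_sinh t)).congr_deriv (by simp))
    (fun t ht => mul_nonneg ht.1.le (Real.sinh_nonneg_iff.2 ht.1.le)) (by simp)
  linarith

/-- In the variable `t = 2h` this reads `2 t sinh t + t² - 6 cosh t + 6 ≥ 0`, which follows by
differentiating three times. -/
theorem three_sinh_sq_le {h : ℝ} (hh : 0 ≤ h) :
    3 * Real.sinh h ^ 2 ≤ 2 * h * Real.sinh h * Real.cosh h + h ^ 2 := by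
  have h3 : ∀ t : ℝ, 0 ≤ t → 0 ≤ 2 + 2 * (t * Real.sinh t) - 2 * Real.cosh t := fun t ht =>
    nonneg_of_hasDerivAt_nonneg (f := fun t => 2 + 2 * (t * Real.sinh t) - 2 * Real.cosh t)
      (f' := fun t => 2 * (t * Real.cosh t)) ht
      (fun t _ => (((((hasDerivAt_id t).mul (Real.hasDerivAt_sinh t)).const_mul 2).const_add 2).sub
        ((Real.hasDerivAt_cosh t).const_mul 2)).congr_deriv (by simp; ring))
      (fun t ht => mul_nonneg zero_le_two (mul_nonneg ht.1.le (Real.cosh_pos t).le)) (by simp)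
  have h2 : ∀ t : ℝ, 0 ≤ t → 0 ≤ 2 * (t * Real.cosh t) + 2 * t - 4 * Real.sinh t := fun t ht =>
    nonneg_of_hasDerivAt_nonneg (f := fun t => 2 * (t * Real.cosh t) + 2 * t - 4 * Real.sinh t)
      (f' := fun t => 2 + 2 * (t * Real.sinh t) - 2 * Real.cosh t) ht
      (fun t _ => (((((hasDerivAt_id t).mul (Real.hasDerivAt_cosh t)).const_mul 2).add
        ((hasDerivAt_id t).const_mul 2)).sub
        ((Real.hasDerivAt_sinh t).const_mul 4)).congr_deriv (by simp; ring))
      (fun t ht => h3 t ht.1.le) (by simp)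
  have h1 : ∀ t : ℝ, 0 ≤ t → 0 ≤ 2 * (t * Real.sinh t) + t ^ 2 - 6 * Real.cosh t + 6 := fun t ht =>
    nonneg_of_hasDerivAt_nonneg
      (f := fun t => 2 * (t * Real.sinh t) + t ^ 2 - 6 * Real.cosh t + 6)
      (f' := fun t => 2 * (t * Real.cosh t) + 2 * t - 4 * Real.sinh t) ht
      (fun t _ => ((((((hasDerivAt_id t).mul (Real.hasDerivAt_sinh t)).const_mul 2).add
        ((hasDerivAt_id t).pow 2)).sub
        ((Real.hasDerivAt_cosh t).const_mul 6)).add_const 6).congr_deriv (by simp; ring))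
      (fun t ht => h2 t ht.1.le) (by simp)
  have := h1 (2 * h) (by positivity)
  rw [Real.sinh_two_mul, Real.cosh_two_mul, Real.cosh_sq] at this
  nlinarith

/-- With `z = 2h` the sign of the derivative becomes a polynomial inequality in `h`, `sinh h`, `cosh
h`, settled by `sinh_le_mul_cosh` and `three_sinh_sq_le`. -/
theorem monotoneOn_elast : MonotoneOn elast (Ioi 0) := by
  have hd : ∀ z ∈ Ioi (0 : ℝ), HasDerivAt elast
      (((Real.exp z - 1) - z * Real.exp z) / (Real.exp z - 1) ^ 2
        - (2 * z * expTwo z - z ^ 2 * (Real.exp z - 1)) / expTwo z ^ 2) z := by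
    intro z hz
    have h2 := (expTwo_pos (ne_of_gt hz)).ne'
    have h1 := (exp_sub_one_pos hz).ne'
    exact ((((hasDerivAt_id z).div ((Real.hasDerivAt_exp z).sub_const 1) h1).const_add 1).sub
      (((hasDerivAt_id z).pow 2).div (hasDerivAt_expTwo z) h2)).congr_deriv (by simp)
  refine monotoneOn_of_deriv_nonneg (convex_Ioi 0)
    (fun z hz => (hd z hz).continuousAt.continuousWithinAt)
    (fun z hz => (hd z (interior_subset hz)).differentiableAt.differentiableWithinAt) ?_
  intro z hz
  rw [interior_Ioi] at hz
  rw [(hd z hz).deriv]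
  have hz0 : 0 < z := hz
  have h2 := expTwo_pos hz0.ne'
  have h1 := exp_sub_one_pos hz0
  set h := z / 2 with hh
  have hzh : z = 2 * h := by rw [hh]; ring
  have hh0 : 0 < h := by positivity
  set s := Real.sinh h with hs
  set C := Real.cosh h with hC
  have hX : Real.exp h = C + s := by rw [hs, hC, Real.cosh_add_sinh]
  have hCs : C ^ 2 = s ^ 2 + 1 := Real.cosh_sq h
  have hsh : h < s := Real.self_lt_sinh_iff.2 hh0
  have hsC : s ≤ h * C := sinh_le_mul_cosh hh0.le
  have h3 : 3 * s ^ 2 ≤ 2 * h * s * C + h ^ 2 := three_sinh_sq_le hh0.le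
  have ha : Real.exp z - 1 = 2 * s * (C + s) := by rw [exp_sub_one_eq, hX]
  have hE : Real.exp z = 2 * s * (C + s) + 1 := by linarith
  have hs0 : 0 < s := hh0.trans hsh
  have hC0 : 0 < C := Real.cosh_pos h
  have hI : 0 ≤ (h * C - s) * (2 * h * s ^ 2 + 2 * h * s * C - s ^ 2 - h ^ 2)
      - h * s * (s ^ 2 - h ^ 2) := by
    have e1 : 2 * h * s ^ 2 ≤ 2 * h * s ^ 2 + 2 * h * s * C - s ^ 2 - h ^ 2 := by
      have : s * s ≤ s * (h * C) := mul_le_mul_of_nonneg_left hsC hs0.le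
      nlinarith
    have e2 := mul_le_mul_of_nonneg_left e1 (sub_nonneg.2 hsC)
    have e3 : 0 ≤ h * s * (2 * h * s * C + h ^ 2 - 3 * s ^ 2) :=
      mul_nonneg (by positivity) (by linarith)
    nlinarith
  have hP : 0 ≤ ((Real.exp z - 1) - z * Real.exp z) * expTwo z ^ 2
      - (2 * z * expTwo z - z ^ 2 * (Real.exp z - 1)) * (Real.exp z - 1) ^ 2 := by
    have : ((Real.exp z - 1) - z * Real.exp z) * expTwo z ^ 2
      - (2 * z * expTwo z - z ^ 2 * (Real.exp z - 1)) * (Real.exp z - 1) ^ 2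
      = 8 * (C + s) ^ 3 * ((h * C - s) * (2 * h * s ^ 2 + 2 * h * s * C - s ^ 2 - h ^ 2)
      - h * s * (s ^ 2 - h ^ 2)) := by
      unfold expTwo
      rw [hE, hzh]
      have hinv : (C - s) * (C + s) = 1 := by linear_combination hCs
      -- The two sides agree only modulo `cosh² - sinh² = 1`; these are the cofactors.
      linear_combination 8 * (-(s ^ 2 * (C + s) ^ 2 * (8 * h ^ 2 - 3 * h))
        - s * (C + s) * (3 * h ^ 2 - 2 * h ^ 3) * (1 + (C - s) * (C + s))
        + h ^ 3 * (1 + (C - s) * (C + s) + ((C - s) * (C + s)) ^ 2)) * hinv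
        + 8 * (C + s) ^ 3 * (h ^ 2 * s - h ^ 3 * (C - s)) * hCs
    rw [this]; positivity
  rw [sub_nonneg, div_le_div_iff₀ (by positivity) (by positivity)]
  linarith

/-- The function `Q z - elast l * log (expTwo z)` has derivative `(elast z - elast l) Q z / z`, so
by monotonicity of `elast` its minimum is at `z = l`. -/
theorem elast_mul_log_le {l a : ℝ} (hl : 0 < l) (ha : 0 < a) :
    elast l * (Real.log (expTwo (l * a)) - Real.log (expTwo l)) ≤ Q (l * a) - Q l := by
  have hd : ∀ z ∈ Ioi (0 : ℝ), HasDerivAt (fun z => Q z - elast l * Real.log (expTwo z))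
      ((elast z - elast l) * (Q z / z)) z := fun z hz =>
    ((hasDerivAt_Q hz).sub ((hasDerivAt_log_expTwo hz).const_mul (elast l))).congr_deriv (by ring)
  have hq : ∀ z ∈ Ioi (0 : ℝ), 0 ≤ Q z / z := fun z hz => (div_pos (Q_pos hz) hz).le
  have hla : 0 < l * a := mul_pos hl ha
  suffices h : Q l - elast l * Real.log (expTwo l)
      ≤ Q (l * a) - elast l * Real.log (expTwo (l * a)) by linarith
  rcases le_total l (l * a) with h | h
  · have : MonotoneOn (fun z => Q z - elast l * Real.log (expTwo z)) (Ici l) := by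
      refine monotoneOn_of_deriv_nonneg (convex_Ici l)
        (fun z hz => (hd z (hl.trans_le hz)).continuousAt.continuousWithinAt)
        (fun z hz => (hd z (hl.trans_le
          (interior_subset hz))).differentiableAt.differentiableWithinAt) ?_
      intro z hz
      have hz' : l ≤ z := interior_subset hz
      rw [(hd z (hl.trans_le hz')).deriv]
      exact mul_nonneg (sub_nonneg.2 (monotoneOn_elast hl (hl.trans_le hz') hz'))
        (hq z (hl.trans_le hz'))
    exact this self_mem_Ici h h
  · have : AntitoneOn (fun z => Q z - elast l * Real.log (expTwo z)) (Ioc 0 l) := by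
      refine antitoneOn_of_deriv_nonpos (convex_Ioc 0 l)
        (fun z hz => (hd z hz.1).continuousAt.continuousWithinAt)
        (fun z hz => (hd z (interior_subset hz).1).differentiableAt.differentiableWithinAt) ?_
      intro z hz
      have hz' : z ∈ Ioc 0 l := interior_subset hz
      rw [(hd z hz'.1).deriv]
      exact mul_nonpos_of_nonpos_of_nonneg (sub_nonpos.2 (monotoneOn_elast hz'.1 hl hz'.2))
        (hq z hz'.1)
    exact this ⟨hla, h⟩ ⟨hl, le_rfl⟩ h

/-- Since `(log expTwo)' = Q z / z`, the numerator of the derivative is the difference estimated in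
`elast_mul_log_le`. -/
theorem monotoneOn_log_expTwo_ratio {a : ℝ} (ha : 0 < a) :
    MonotoneOn (fun l => (Real.log (expTwo (l * a)) - Real.log (expTwo l)) / Q l) (Ioi 0) := by
  have hd : ∀ l ∈ Ioi (0 : ℝ),
      HasDerivAt (fun l => (Real.log (expTwo (l * a)) - Real.log (expTwo l)) / Q l)
      ((Q (l * a) - Q l - elast l * (Real.log (expTwo (l * a)) - Real.log (expTwo l)))
        / (l * Q l)) l := by
    intro l hl
    have hl0 : 0 < l := hl
    have hQ := (Q_pos hl).ne'
    have h1 : HasDerivAt (fun l => Real.log (expTwo (l * a))) (Q (l * a) / (l * a) * a) l := by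
      have := (hasDerivAt_log_expTwo (mul_pos hl0 ha)).comp l ((hasDerivAt_id l).mul_const a)
      exact this.congr_deriv (by ring)
    refine ((h1.sub (hasDerivAt_log_expTwo hl)).div (hasDerivAt_Q hl) hQ).congr_deriv ?_
    simp only [Pi.sub_apply]
    field_simp
  refine monotoneOn_of_deriv_nonneg (convex_Ioi 0)
    (fun z hz => (hd z hz).continuousAt.continuousWithinAt)
    (fun z hz => (hd z (interior_subset hz)).differentiableAt.differentiableWithinAt) ?_
  intro l hl
  rw [interior_Ioi] at hl
  rw [(hd l hl).deriv]
  have := elast_mul_log_le hl ha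
  exact div_nonneg (by linarith) (mul_pos hl (Q_pos hl)).le

/-- The power mean inequality: Jensen for `t ↦ t^(d/c)`. -/
theorem log_mean_exp_le {c d F G : ℝ} (hc : 0 < c) (hcd : c ≤ d) :
    1 / c * Real.log ((Real.exp (c * F) + Real.exp (c * G)) / 2)
      ≤ 1 / d * Real.log ((Real.exp (d * F) + Real.exp (d * G)) / 2) := by
  have hd : 0 < d := hc.trans_le hcd
  have hp : 1 ≤ d / c := (one_le_div hc).2 hcd
  have h := (convexOn_rpow hp).2 (Real.exp_pos (c * F)).le (Real.exp_pos (c * G)).le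
    (by norm_num : (0 : ℝ) ≤ 1 / 2) (by norm_num : (0 : ℝ) ≤ 1 / 2) (by norm_num)
  simp only [smul_eq_mul, ← Real.exp_mul] at h
  have e1 : ∀ F, c * F * (d / c) = d * F := fun F => by field_simp
  rw [e1, e1] at h
  have hpos : 0 < 1 / 2 * Real.exp (c * F) + 1 / 2 * Real.exp (c * G) := by positivity
  have h' := Real.log_le_log (Real.rpow_pos_of_pos hpos _) h
  rw [Real.log_rpow hpos] at h'
  have e2 : ∀ A B : ℝ, 1 / 2 * A + 1 / 2 * B = (A + B) / 2 := fun A B => by ring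
  rw [e2, e2] at h'
  have h3 := mul_le_mul_of_nonneg_left h' (one_div_pos.2 hd).le
  calc _ = 1 / d * (d / c * Real.log ((Real.exp (c * F) + Real.exp (c * G)) / 2)) := by
        field_simp
    _ ≤ _ := h3

/-- The normalised logarithm of the generating function increases with the parameter. -/
theorem log_expTwo_mean_mono {l m a b : ℝ} (hl : 0 < l) (hlm : l ≤ m) (ha : 0 < a) (hb : 0 < b) :
    1 / Q l * Real.log ((expTwo (l * a) + expTwo (l * b)) / (2 * expTwo l))
      ≤ 1 / Q m * Real.log ((expTwo (m * a) + expTwo (m * b)) / (2 * expTwo m)) := by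
  have hm : 0 < m := hl.trans_le hlm
  have hexp : ∀ {l a : ℝ}, 0 < l → 0 < a → expTwo (l * a) / expTwo l
      = Real.exp (Q l * ((Real.log (expTwo (l * a)) - Real.log (expTwo l)) / Q l)) := by
    intro l a hl ha
    have := (Q_pos hl).ne'
    rw [mul_div_cancel₀ _ this, Real.exp_sub, Real.exp_log (expTwo_pos (mul_pos hl ha).ne'),
      Real.exp_log (expTwo_pos hl.ne')]
  have hsum : ∀ {l : ℝ}, 0 < l → (expTwo (l * a) + expTwo (l * b)) / (2 * expTwo l)
      = (expTwo (l * a) / expTwo l + expTwo (l * b) / expTwo l) / 2 := by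
    intro l hl
    have := (expTwo_pos hl.ne').ne'
    field_simp
  rw [hsum hl, hsum hm, hexp hl ha, hexp hl hb, hexp hm ha, hexp hm hb]
  have hQl := Q_pos hl
  have hQm := Q_pos hm
  have hQ : Q l ≤ Q m := strictMonoOn_Q.monotoneOn hl hm hlm
  -- The exponent grows from `Q l` to `Q m` with the normalised logarithms fixed; then these
  -- logarithms grow.
  refine (log_mean_exp_le hQl hQ).trans ?_
  have h1 := monotoneOn_log_expTwo_ratio ha hl hm hlm
  have h2 := monotoneOn_log_expTwo_ratio hb hl hm hlm
  simp only at h1 h2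
  gcongr

/-! ### The inverse of `Q` on `(2, ∞)`. -/

theorem Q_le_two_of_nonpos {z : ℝ} (hz : z ≤ 0) : Q z ≤ 2 := by
  rcases hz.eq_or_lt with rfl | hz
  · simp [Q]
  have h2 := expTwo_pos hz.ne
  rw [Q, if_neg hz.ne, div_le_iff₀ h2]
  have h := nonneg_of_hasDerivAt_nonneg (f := fun t => (t + 2) * Real.exp (-t) + t - 2)
    (f' := fun t => 1 - (t + 1) * Real.exp (-t)) (x := -z) (by linarith)
    (fun t _ => ((((((hasDerivAt_id t).add_const 2).mul (hasDerivAt_neg t).exp)).add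
      (hasDerivAt_id t)).sub_const 2).congr_deriv (by simp; ring))
    (fun t _ => by
      have h1 := Real.add_one_le_exp t
      have h2 : Real.exp t * Real.exp (-t) = 1 := by rw [← Real.exp_add]; simp
      have h3 := Real.exp_pos (-t)
      nlinarith) (by simp)
  simp only [neg_neg] at h
  unfold expTwo
  nlinarith

theorem Q_le_add_two {z : ℝ} (hz : 0 < z) : Q z ≤ z + 2 := by
  rw [Q_eq_add hz]
  have h2 := expTwo_pos hz.ne'
  have h3 := Real.quadratic_le_exp_of_nonneg hz.le
  have : z ^ 2 / expTwo z ≤ 2 := by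
    rw [div_le_iff₀ h2]; unfold expTwo; linarith
  linarith

theorem self_lt_Q {z : ℝ} (hz : 0 < z) : z < Q z := by
  rw [Q_eq_add hz]
  have h2 := expTwo_pos hz.ne'
  have := div_pos (pow_pos hz 2) h2
  linarith

theorem exists_Q_eq {c : ℝ} (hc : 2 < c) : ∃ z, 0 < z ∧ Q z = c := by
  have hcont : ContinuousOn Q (Icc ((c - 2) / 2) c) := fun z hz =>
    (hasDerivAt_Q (by linarith [hz.1] : (0 : ℝ) < z)).continuousAt.continuousWithinAt
  have h1 : Q ((c - 2) / 2) ≤ c := (Q_le_add_two (by linarith)).trans (by linarith)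
  have h2 : c ≤ Q c := (self_lt_Q (by linarith)).le
  obtain ⟨z, hz, hzc⟩ := intermediate_value_Icc (by linarith) hcont ⟨h1, h2⟩
  exact ⟨z, by linarith [hz.1], hzc⟩

theorem Q_QInv {c : ℝ} (hc : 2 < c) : Q (QInv c) = c := by
  obtain ⟨z, -, hz⟩ := exists_Q_eq hc
  exact Function.invFun_eq ⟨z, hz⟩

theorem QInv_pos {c : ℝ} (hc : 2 < c) : 0 < QInv c := by
  by_contra h
  have := Q_le_two_of_nonpos (not_lt.1 h)
  rw [Q_QInv hc] at this
  linarith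

theorem strictMonoOn_QInv : StrictMonoOn QInv (Ioi 2) := by
  intro a ha b hb hab
  have := strictMonoOn_Q.lt_iff_lt (QInv_pos ha) (QInv_pos hb)
  rw [Q_QInv ha, Q_QInv hb] at this
  exact this.1 hab

theorem two_lt_Q {z : ℝ} (hz : 0 < z) : 2 < Q z := by
  rw [Q_of_pos hz, lt_div_iff₀ (expTwo_pos hz.ne')]
  have hd : StrictMonoOn (fun t => (t - 2) * Real.exp t + t + 2) (Ici 0) := by
    have hder : ∀ t : ℝ, HasDerivAt (fun t => (t - 2) * Real.exp t + t + 2)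
        ((t - 1) * Real.exp t + 1) t := fun t => ((((((hasDerivAt_id t).sub_const 2).mul
      (Real.hasDerivAt_exp t)).add (hasDerivAt_id t)).add_const 2).congr_deriv (by simp; ring))
    refine strictMonoOn_of_deriv_pos (convex_Ici 0)
      (fun t _ => (hder t).continuousAt.continuousWithinAt) ?_
    intro t ht
    rw [interior_Ici] at ht
    rw [(hder t).deriv]
    have h1 := Real.add_one_lt_exp (x := -t) (neg_ne_zero.2 (ne_of_gt ht))
    have h2 : Real.exp t * Real.exp (-t) = 1 := by rw [← Real.exp_add]; simp
    have h3 := Real.exp_pos t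
    nlinarith
  have := hd self_mem_Ici hz.le hz
  simp at this
  unfold expTwo
  linarith

/-- A monotone function is continuous where its image is a neighbourhood of the value; here the
image is `(0, ∞)`. -/
theorem continuousAt_QInv {c : ℝ} (hc : 2 < c) : ContinuousAt QInv c := by
  refine continuousAt_of_monotoneOn_of_image_mem_nhds strictMonoOn_QInv.monotoneOn
    (Ioi_mem_nhds hc) ?_
  have : QInv '' Ioi 2 = Ioi 0 := by
    ext z
    constructor
    · rintro ⟨a, ha, rfl⟩
      exact QInv_pos ha
    · intro hz
      refine ⟨Q z, two_lt_Q hz, ?_⟩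
      exact strictMonoOn_Q.injOn (QInv_pos (two_lt_Q hz)) hz (Q_QInv (two_lt_Q hz))
  rw [this]
  exact Ioi_mem_nhds (QInv_pos hc)

/-! ### The estimate of `J` for small `α`. -/

/-- A Padé upper bound for `tanh`, used to integrate up to `log cosh`. -/
theorem sinh_mul_le_pade {z : ℝ} (hz : 0 ≤ z) :
    Real.sinh z * (6 * z ^ 2 + 15) ≤ (z ^ 3 + 15 * z) * Real.cosh z := by
  have h2 : ∀ t : ℝ, 0 ≤ t → 0 ≤ (t ^ 2 + 3) * Real.sinh t - 3 * (t * Real.cosh t) := fun t ht =>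
    nonneg_of_hasDerivAt_nonneg (f := fun t => (t ^ 2 + 3) * Real.sinh t - 3 * (t * Real.cosh t))
      (f' := fun t => t * (t * Real.cosh t - Real.sinh t)) ht
      (fun t _ => (((((hasDerivAt_id t).pow 2).add_const 3).mul (Real.hasDerivAt_sinh t)).sub
        (((hasDerivAt_id t).mul (Real.hasDerivAt_cosh t)).const_mul 3)).congr_deriv
        (by simp; ring))
      (fun t ht => mul_nonneg ht.1.le (sub_nonneg.2 (sinh_le_mul_cosh ht.1.le))) (by simp)
  have := nonneg_of_hasDerivAt_nonneg
    (f := fun t => (t ^ 3 + 15 * t) * Real.cosh t - Real.sinh t * (6 * t ^ 2 + 15))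
    (f' := fun t => t * ((t ^ 2 + 3) * Real.sinh t - 3 * (t * Real.cosh t))) hz
    (fun t _ => (((((hasDerivAt_id t).pow 3).add ((hasDerivAt_id t).const_mul 15)).mul
      (Real.hasDerivAt_cosh t)).sub ((Real.hasDerivAt_sinh t).mul
      ((((hasDerivAt_id t).pow 2).const_mul 6).add_const 15))).congr_deriv (by simp; ring))
    (fun t ht => mul_nonneg ht.1.le (h2 t ht.1.le)) (by simp)
  linarith

/-- The quartic constant is the largest for which the derivative dominates the Padé bound whenever
`z² ≤ M`; as `M → 0` it tends to the Taylor value `1/12`. -/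
theorem log_cosh_le {z M : ℝ} (hz : 0 ≤ z) (hM : z ^ 2 ≤ M) :
    Real.log (Real.cosh z) ≤ z ^ 2 / 2 - 5 / (60 + 24 * M) * z ^ 4 := by
  have hM0 : 0 ≤ M := (sq_nonneg z).trans hM
  set κ := 5 / (60 + 24 * M) with hκ
  have hκM : κ * (60 + 24 * M) = 5 := by rw [hκ]; field_simp
  have hκ0 : 0 ≤ κ := by positivity
  have := nonneg_of_hasDerivAt_nonneg
    (f := fun t => t ^ 2 / 2 - κ * t ^ 4 - Real.log (Real.cosh t))
    (f' := fun t => t - 4 * κ * t ^ 3 - Real.sinh t / Real.cosh t) hz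
    (fun t _ => (((((hasDerivAt_id t).pow 2).div_const 2).sub
      (((hasDerivAt_id t).pow 4).const_mul κ)).sub
      ((Real.hasDerivAt_cosh t).log (Real.cosh_pos t).ne')).congr_deriv (by simp; ring))
    (fun t ht => by
      have htz : t ^ 2 ≤ M := (pow_le_pow_left₀ ht.1.le ht.2.le 2).trans hM
      have hc := Real.cosh_pos t
      have hp := sinh_mul_le_pade ht.1.le
      have hk : κ * (60 + 24 * t ^ 2) ≤ 5 := by
        rw [← hκM]; gcongr
      rw [sub_nonneg, div_le_iff₀ hc]
      have e : t ^ 3 + 15 * t ≤ (t - 4 * κ * t ^ 3) * (6 * t ^ 2 + 15) := by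
        have : 0 ≤ t ^ 3 * (5 - κ * (60 + 24 * t ^ 2)) :=
          mul_nonneg (pow_nonneg ht.1.le 3) (by linarith)
        nlinarith
      have e2 := mul_le_mul_of_nonneg_right e hc.le
      have e3 : 0 < 6 * t ^ 2 + 15 := by positivity
      refine le_of_mul_le_mul_right ?_ e3
      linarith) (by simp)
  linarith

theorem expTwo_add_expTwo (l x : ℝ) (hl : 0 < l) :
    (expTwo (l * (1 + x)) + expTwo (l * (1 - x))) / (2 * expTwo l)
      = 1 + Real.exp l / expTwo l * (Real.cosh (l * x) - 1) := by
  have h := (expTwo_pos hl.ne').ne'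
  field_simp
  have e1 : Real.exp (l * (1 + x)) = Real.exp l * Real.exp (l * x) := by
    rw [← Real.exp_add]; ring_nf
  have e2 : Real.exp (l * (1 - x)) = Real.exp l * Real.exp (-(l * x)) := by
    rw [← Real.exp_add]; ring_nf
  rw [Real.cosh_eq]
  unfold expTwo
  rw [e1, e2]
  ring

/-- The mean equals `1 + G (cosh (lx) - 1)` with `G = e^l / exp₂(l) ≥ 1`, which Bernoulli bounds by
`cosh (lx) ^ G`; moreover `G l² / Q l = 1 + l - l / Q l`. -/
theorem log_expTwo_mean_le {l x M : ℝ} (hl : 0 < l) (hx : 0 ≤ x) (hM : (l * x) ^ 2 ≤ M) :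
    1 / Q l * Real.log ((expTwo (l * (1 + x)) + expTwo (l * (1 - x))) / (2 * expTwo l))
      ≤ (1 + l - l / Q l) * (x ^ 2 / 2 - 5 / (60 + 24 * M) * l ^ 2 * x ^ 4) := by
  have h := expTwo_pos hl.ne'
  have h1 := exp_sub_one_pos hl
  have hQ := Q_pos hl
  rw [expTwo_add_expTwo l x hl]
  set G := Real.exp l / expTwo l with hG
  have hG1 : 1 ≤ G := by
    rw [hG, le_div_iff₀ h]; unfold expTwo; linarith
  have hch := Real.one_le_cosh (l * x)
  have hb := one_add_mul_self_le_rpow_one_add (s := Real.cosh (l * x) - 1) (by linarith) hG1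
  have e0 : 1 + (Real.cosh (l * x) - 1) = Real.cosh (l * x) := by ring
  rw [e0] at hb
  have hlog : Real.log (1 + G * (Real.cosh (l * x) - 1)) ≤ G * Real.log (Real.cosh (l * x)) := by
    rw [← Real.log_rpow (Real.cosh_pos _)]
    refine Real.log_le_log ?_ hb
    have := mul_nonneg (zero_le_one.trans hG1) (sub_nonneg.2 hch)
    linarith
  have hc := log_cosh_le (mul_nonneg hl.le hx) hM
  have hγ : 1 + l - l / Q l = 1 / Q l * G * l ^ 2 := by
    rw [Q_of_pos hl, hG]
    field_simp
    unfold expTwo; ring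
  rw [hγ]
  have hG0 : 0 ≤ G := zero_le_one.trans hG1
  calc 1 / Q l * Real.log (1 + G * (Real.cosh (l * x) - 1))
      ≤ 1 / Q l * (G * ((l * x) ^ 2 / 2 - 5 / (60 + 24 * M) * (l * x) ^ 4)) := by
        gcongr; exact hlog.trans (by gcongr)
    _ = _ := by ring

theorem one_sub_mul_log_le {a : ℝ} (h0 : 0 ≤ a) (h1 : a ≤ 1 / 3) :
    (1 - a) * Real.log (1 - a) + a ≤ a ^ 2 / 2 + a ^ 3 / 4 := by
  have hlog : ∀ t ∈ Icc (0 : ℝ) (1 / 3), 0 ≤ t + 3 / 4 * t ^ 2 + Real.log (1 - t) := fun t ht =>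
    nonneg_of_hasDerivAt_nonneg (f := fun t => t + 3 / 4 * t ^ 2 + Real.log (1 - t))
      (f' := fun t => 1 + 3 / 2 * t - 1 / (1 - t)) ht.1
      (fun s hs => (((hasDerivAt_id s).add (((hasDerivAt_id s).pow 2).const_mul (3 / 4))).add
        (((hasDerivAt_id s).const_sub 1).log
          (by simp only [id]; linarith [hs.2, ht.2]))).congr_deriv (by simp; ring))
      (fun s hs => by
        have : 0 < 1 - s := by linarith [hs.2, ht.2]
        rw [sub_nonneg, div_le_iff₀ this]
        nlinarith [hs.1, hs.2, ht.2, mul_nonneg hs.1.le (by linarith [hs.2, ht.2] : 0 ≤ 1 / 3 - s)])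
      (by simp)
  have := nonneg_of_hasDerivAt_nonneg
    (f := fun t => t ^ 2 / 2 + t ^ 3 / 4 - (1 - t) * Real.log (1 - t) - t)
    (f' := fun t => t + 3 / 4 * t ^ 2 + Real.log (1 - t)) h0
    (fun s hs => by
      have hs1 : 1 - s ≠ 0 := by linarith [hs.2]
      refine (((((((hasDerivAt_id s).pow 2).div_const 2).add
        (((hasDerivAt_id s).pow 3).div_const 4)).sub
        (((hasDerivAt_id s).const_sub 1).mul (((hasDerivAt_id s).const_sub 1).log hs1))).sub
        (hasDerivAt_id s))).congr_deriv ?_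
      simp
      field_simp
      ring)
    (fun s hs => hlog s ⟨hs.1.le, by linarith [hs.2]⟩) (by simp)
  linarith

theorem neg_mul_log_beta {K : ℕ} (hK : 3 ≤ K) :
    -(1 / 2 - 1 / (K : ℝ)) * Real.log (beta K)
      = 1 / (K : ℝ) + Real.log ((K : ℝ) - 1) / 2 - 1 + (K : ℝ) / (2 * ((K : ℝ) - 1)) := by
  have hK' : (3 : ℝ) ≤ K := by exact_mod_cast hK
  rw [beta, Real.log_exp, Real.log_sqrt (by linarith)]
  have h1 : (K : ℝ) - 2 ≠ 0 := by linarith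
  have h2 : (K : ℝ) - 1 ≠ 0 := by linarith
  have h3 : (1 / 2 - 1 / (K : ℝ)) ≠ 0 := by
    have : (1 / 2 - 1 / (K : ℝ)) = ((K : ℝ) - 2) / (2 * K) := by field_simp
    rw [this]; positivity
  rw [neg_mul, mul_div_cancel₀ _ h3, neg_neg]

/-- With `x² = α/(K-1)`, the summands `ln √(K-1)` and `K/(2(K-1))` in `β_K` come from `-α log x` and
`K x²/2`. `hcond` says that the higher-order terms of `(1-α) log (1-α)` fit into the slack `K - (1 +
λ - λ/K)` plus the quartic gain. -/
theorem J_small_le {K : ℕ} (hK : 3 ≤ K) {c α M : ℝ} (hc : 2 < c) (hcK : c ≤ K)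
    (h0 : 0 < α) (h1 : α ≤ 1 / 3) (hM : QInv K ^ 2 * α ≤ M * ((K : ℝ) - 1))
    (hcond : (((K : ℝ) - 1) ^ 2 / K) * α * (1 + α / 2)
      + (1 + QInv K - QInv K / K) * (1 - 10 / (60 + 24 * M) * QInv K ^ 2 * (α / ((K : ℝ) - 1)))
        ≤ K) :
    J K α (Real.sqrt (α / ((K : ℝ) - 1)), 1) c
      ≤ (1 / 2 - 1 / (K : ℝ)) * α * Real.log (α / beta K) := by
  have hK' : (3 : ℝ) ≤ K := by exact_mod_cast hK
  have hk : (0 : ℝ) < (K : ℝ) - 1 := by linarith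
  have hK2 : (2 : ℝ) < K := by linarith
  set x := Real.sqrt (α / ((K : ℝ) - 1)) with hx
  have hx2 : x ^ 2 = α / ((K : ℝ) - 1) := Real.sq_sqrt (by positivity)
  have hx0 : 0 < x := Real.sqrt_pos.2 (by positivity)
  have hx1 : x < 1 := by
    rw [hx, Real.sqrt_lt' one_pos, div_lt_iff₀ hk]; linarith
  have hl := QInv_pos hK2
  have hQ := Q_QInv hK2
  have hlc := QInv_pos hc
  have hmono := log_expTwo_mean_mono (a := 1 + x) (b := 1 - x) hlc
    (strictMonoOn_QInv.monotoneOn hc hK2 hcK) (by linarith) (by linarith)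
  have hle := log_expTwo_mean_le (l := QInv K) (x := x) (M := M) hl hx0.le (by
    rw [mul_pow, hx2, ← mul_div_assoc, div_le_iff₀ hk]; exact hM)
  rw [Q_QInv hc, hQ] at hmono
  rw [hQ] at hle
  have hE := hmono.trans hle
  have hlogx : Real.log (α / x) = Real.log α / 2 + Real.log ((K : ℝ) - 1) / 2 := by
    rw [Real.log_div h0.ne' hx0.ne', hx, Real.log_sqrt (by positivity),
      Real.log_div h0.ne' hk.ne']
    ring
  have hbeta : 0 < beta K := Real.exp_pos _
  have hlb := neg_mul_log_beta hK
  have hent := one_sub_mul_log_le h0.le h1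
  unfold J H
  simp only
  rw [hlogx, div_one, Real.log_div h0.ne' hbeta.ne']
  set L := Real.log α
  set L1 := Real.log (1 - α)
  set LE := 1 / c * Real.log ((expTwo (QInv c * (1 + x)) + expTwo (QInv c * (1 - x)))
        / (2 * expTwo (QInv c)))
  set t := α / ((K : ℝ) - 1) with ht
  have hα : α = ((K : ℝ) - 1) * t := by rw [ht]; field_simp
  have ht0 : 0 < t := by positivity
  have h4 : x ^ 4 = t ^ 2 := by rw [← hx2]; ring
  rw [h4, hx2] at hE
  have hmain : (1 - 1 / (K : ℝ)) * (α ^ 2 / 2 + α ^ 3 / 4)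
      + (1 + QInv K - QInv K / K) * (t / 2 - 5 / (60 + 24 * M) * QInv K ^ 2 * t ^ 2)
      ≤ K * t / 2 := by
    have h := mul_le_mul_of_nonneg_left hcond (by positivity : 0 ≤ t / 2)
    have e : (1 - 1 / (K : ℝ)) * (α ^ 2 / 2 + α ^ 3 / 4)
        = t / 2 * ((((K : ℝ) - 1) ^ 2 / K) * α * (1 + α / 2)) := by
      rw [ht]; field_simp
      ring
    have e2 : (10 : ℝ) / (60 + 24 * M) = 2 * (5 / (60 + 24 * M)) := by ring
    rw [e]
    rw [e2] at h
    linarith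
  have hKi : 0 ≤ 1 - 1 / (K : ℝ) := by
    rw [sub_nonneg, div_le_one (by linarith)]; linarith
  have hent' := mul_le_mul_of_nonneg_left hent hKi
  have hbt : (1 / 2 - 1 / (K : ℝ)) * α * (L - Real.log (beta K))
      = (1 / 2 - 1 / (K : ℝ)) * α * L + α * (1 / (K : ℝ) + Real.log ((K : ℝ) - 1) / 2 - 1
        + (K : ℝ) / (2 * ((K : ℝ) - 1))) := by
    rw [← hlb]; ring
  have hKt : α * ((K : ℝ) / (2 * ((K : ℝ) - 1))) = K * t / 2 := by
    rw [ht]; field_simp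
  rw [hbt]
  linear_combination hE + hent' + hmain - hKt

/-! ### Numerical bounds for `Q⁻¹(K)` and `β_K`, and the small-`α` bound for every `K`. -/

/-- From `Q z = z + z² / exp₂(z)`, locating `Q⁻¹(c)` needs only a bound on `e^z`. -/
theorem le_QInv {z c : ℝ} (hz : 0 < z) (hc : 2 < c) (h : z ^ 2 ≤ (c - z) * expTwo z) :
    z ≤ QInv c := by
  have hQ : Q z ≤ Q (QInv c) := by
    rw [Q_QInv hc, Q_eq_add hz]
    have := (div_le_iff₀ (expTwo_pos hz.ne')).2 h
    linarith
  exact (strictMonoOn_Q.le_iff_le hz (QInv_pos hc)).1 hQ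

theorem QInv_le {z c : ℝ} (hz : 0 < z) (hc : 2 < c) (h : (c - z) * expTwo z ≤ z ^ 2) :
    QInv c ≤ z := by
  have hQ : Q (QInv c) ≤ Q z := by
    rw [Q_QInv hc, Q_eq_add hz]
    have := (le_div_iff₀ (expTwo_pos hz.ne')).2 h
    linarith
  exact (strictMonoOn_Q.le_iff_le (QInv_pos hc) hz).1 hQ

theorem QInv_lt {c : ℝ} (hc : 2 < c) : QInv c < c := by
  have := self_lt_Q (QInv_pos hc)
  rwa [Q_QInv hc] at this

theorem exp_div_le {p n : ℕ} (hn : n ≠ 0) {q : ℝ} (hq : 0 ≤ q) (h : (2.7182818286 : ℝ) ^ p ≤ q ^ n) :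
    Real.exp (p / n : ℝ) ≤ q := by
  refine le_of_pow_le_pow_left₀ hn hq ?_
  rw [← Real.exp_nat_mul, mul_div_cancel₀ _ (Nat.cast_ne_zero.2 hn), ← mul_one (p : ℝ),
    Real.exp_nat_mul]
  exact (pow_le_pow_left₀ (Real.exp_pos _).le Real.exp_one_lt_d9.le _).trans h

theorem le_exp_div {p n : ℕ} (hn : n ≠ 0) {q : ℝ} (h : q ^ n ≤ (2.7182818283 : ℝ) ^ p) :
    q ≤ Real.exp (p / n : ℝ) := by
  refine le_of_pow_le_pow_left₀ hn (Real.exp_pos _).le ?_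
  rw [← Real.exp_nat_mul, mul_div_cancel₀ _ (Nat.cast_ne_zero.2 hn), ← mul_one (p : ℝ),
    Real.exp_nat_mul]
  exact h.trans (pow_le_pow_left₀ (by norm_num) Real.exp_one_gt_d9.le _)

theorem beta_pos (K : ℕ) : 0 < beta K := Real.exp_pos _

theorem beta_le_of_log {K : ℕ} {p n : ℕ} (hn : n ≠ 0) {q : ℝ} (hq : 0 < q)
    (hL : Real.log (beta K) ≤ -(p / n : ℝ)) (h : 1 ≤ q ^ n * (2.7182818283 : ℝ) ^ p) :
    beta K ≤ q := by
  rw [← Real.exp_log (beta_pos K)]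
  refine (Real.exp_le_exp.2 hL).trans ?_
  rw [Real.exp_neg]
  refine inv_le_of_inv_le₀ hq ?_
  refine le_exp_div hn ?_
  rw [inv_pow, inv_le_iff_one_le_mul₀ (pow_pos hq n)]
  linarith

theorem le_beta_of_log {K : ℕ} {p n : ℕ} (hn : n ≠ 0) {q : ℝ} (hq : 0 < q)
    (hL : -(p / n : ℝ) ≤ Real.log (beta K)) (h : q ^ n * (2.7182818286 : ℝ) ^ p ≤ 1) :
    q ≤ beta K := by
  rw [← Real.exp_log (beta_pos K)]
  refine le_trans ?_ (Real.exp_le_exp.2 hL)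
  rw [Real.exp_neg]
  refine (le_inv_comm₀ hq (Real.exp_pos _)).2 ?_
  refine exp_div_le hn (inv_nonneg.2 hq.le) ?_
  rw [inv_pow, le_inv_comm₀ (by positivity) (pow_pos hq n), ← one_div,
    le_div_iff₀ (by positivity)]
  linarith

theorem log_six_bounds : 1.79175946 < Real.log 6 ∧ Real.log 6 < 1.79175947 := by
  have h : Real.log 6 = Real.log 2 + Real.log 3 := by
    rw [← Real.log_mul (by norm_num) (by norm_num)]; norm_num
  have h1 := Real.log_two_gt_d9
  have h2 := Real.log_two_lt_d9
  have h3 := Real.log_three_gt_d9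
  have h4 := Real.log_three_lt_d9
  rw [h]
  constructor <;> linarith

theorem log_beta_three : Real.log (beta 3) = -(1 / 2) - 3 * Real.log 2 := by
  have := neg_mul_log_beta (K := 3) le_rfl
  norm_num at this
  linarith

theorem log_beta_four : Real.log (beta 4) = 1 / 3 - 2 * Real.log 3 := by
  have := neg_mul_log_beta (K := 4) (by norm_num)
  norm_num at this
  linarith

theorem log_beta_five : Real.log (beta 5) = 7 / 12 - 10 / 3 * Real.log 2 := by
  have := neg_mul_log_beta (K := 5) (by norm_num)
  have h4 := Real.log_four_eq
  norm_num at this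
  linarith

theorem log_beta_six : Real.log (beta 6) = 7 / 10 - 3 / 2 * Real.log 5 := by
  have := neg_mul_log_beta (K := 6) (by norm_num)
  norm_num at this
  linarith

theorem log_beta_seven : Real.log (beta 7) = 23 / 30 - 7 / 5 * Real.log 6 := by
  have := neg_mul_log_beta (K := 7) (by norm_num)
  norm_num at this
  linarith

/-- This form shows that `(K-1) β_K` stays below `e`, so that `β_K` is of order `1/K`. -/
theorem log_mul_beta {K : ℕ} (hK : 3 ≤ K) :
    Real.log (((K : ℝ) - 1) * beta K)
      = 1 - (2 * Real.log ((K : ℝ) - 1) + 1 + 1 / ((K : ℝ) - 1)) / ((K : ℝ) - 2) := by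
  have hK' : (3 : ℝ) ≤ K := by exact_mod_cast hK
  have h := neg_mul_log_beta hK
  have h1 : (K : ℝ) - 2 ≠ 0 := by linarith
  have h2 : (K : ℝ) - 1 ≠ 0 := by linarith
  have h3 : (K : ℝ) ≠ 0 := by linarith
  rw [Real.log_mul h2 (beta_pos K).ne']
  set b := Real.log (beta K)
  set L := Real.log ((K : ℝ) - 1)
  have hb : b * ((K : ℝ) - 2) = -2 - K * L + 2 * K - (K + 1 + 1 / ((K : ℝ) - 1)) := by
    have e : (K : ℝ) + 1 + 1 / ((K : ℝ) - 1) = 2 * K * (K / (2 * ((K : ℝ) - 1))) := by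
      field_simp; ring
    have e2 : b * ((K : ℝ) - 2) = -(2 * K) * (-(1 / 2 - 1 / (K : ℝ)) * b) := by
      field_simp
    rw [e2, h, e]
    field_simp
    ring
  rw [eq_sub_iff_add_eq, ← eq_sub_iff_add_eq', div_eq_iff h1]
  linear_combination hb

theorem mul_beta_le {K : ℕ} (hK : 3 ≤ K) {p n : ℕ} (hn : n ≠ 0) {b : ℝ} (hb : 0 ≤ b)
    (h : (2.7182818286 : ℝ) ^ p ≤ b ^ n)
    (hL : (1 - (p / n : ℝ)) * ((K : ℝ) - 2)
      ≤ 2 * Real.log ((K : ℝ) - 1) + 1 + 1 / ((K : ℝ) - 1)) : ((K : ℝ) - 1) * beta K ≤ b := by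
  have hK' : (3 : ℝ) ≤ K := by exact_mod_cast hK
  have hpos : 0 < ((K : ℝ) - 1) * beta K := mul_pos (by linarith) (beta_pos K)
  rw [← Real.exp_log hpos, log_mul_beta hK]
  refine (Real.exp_le_exp.2 ?_).trans (exp_div_le hn hb h)
  have : 0 < (K : ℝ) - 2 := by linarith
  have := (le_div_iff₀ this).2 hL
  linarith

theorem sub_le_QInv {K : ℝ} (hK : 8 ≤ K) : K - 1 / 20 ≤ QInv K := by
  set z := K - 1 / 20 with hz
  have hz1 : 7.95 ≤ z := by rw [hz]; linarith
  refine le_QInv (by linarith) (by linarith) ?_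
  have h := Real.sum_le_exp_of_nonneg (x := z) (by linarith) 9
  norm_num [Finset.sum_range_succ, Nat.factorial] at h
  have hKz : K - z = 1 / 20 := by rw [hz]; ring
  rw [hKz]
  unfold expTwo
  have h1 : 7.95 ^ 2 ≤ z ^ 2 := by gcongr
  have h2 : (7.95 ^ 2) * 7.95 * z ^ 2 ≤ z ^ 5 := by
    calc _ ≤ z ^ 2 * z * z ^ 2 := by gcongr
      _ = _ := by ring
  have h3 : (7.95 ^ 2) * z ^ 2 ≤ z ^ 4 := by
    calc _ ≤ z ^ 2 * z ^ 2 := by gcongr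
      _ = _ := by ring
  have h4 : (7.95 ^ 2) ^ 2 * z ^ 2 ≤ z ^ 6 := by
    calc _ ≤ (z ^ 2) ^ 2 * z ^ 2 := by gcongr
      _ = _ := by ring
  have h5 : (7.95 ^ 2) ^ 2 * 7.95 * z ^ 2 ≤ z ^ 7 := by
    calc _ ≤ (z ^ 2) ^ 2 * z * z ^ 2 := by gcongr
      _ = _ := by ring
  have h6 : (7.95 ^ 2) ^ 3 * z ^ 2 ≤ z ^ 8 := by
    calc _ ≤ (z ^ 2) ^ 3 * z ^ 2 := by gcongr
      _ = _ := by ring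
  have h7 : 0 ≤ z ^ 3 := by positivity
  norm_num at h1 h2 h3 h4 h5 h6
  nlinarith

/-- It suffices to check the condition at `α = A`: scaled by `α/A` it gives the terms proportional
to `α`, and the remaining fraction `1 - α/A` of the slack `K - (1 + u - u/K)` is nonnegative. -/
theorem J_small_le_of_bounds {K : ℕ} (hK : 3 ≤ K) {c α M A u l : ℝ} (hc : 2 < c) (hcK : c ≤ K)
    (h0 : 0 < α) (hA : α ≤ A) (hA1 : A ≤ 1 / 3) (hl0 : 0 ≤ l) (hl : l ≤ QInv K) (hu : QInv K ≤ u)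
    (hM : u ^ 2 * A ≤ M * ((K : ℝ) - 1))
    (hcond : (((K : ℝ) - 1) ^ 2 / K) * A * (1 + A / 2) + (1 + u - u / K)
      ≤ K + (1 + l - l / K) * (10 / (60 + 24 * M)) * l ^ 2 * (A / ((K : ℝ) - 1))) (hM0 : 0 ≤ M)
    (hcond0 : u ≤ K) :
    J K α (Real.sqrt (α / ((K : ℝ) - 1)), 1) c
      ≤ (1 / 2 - 1 / (K : ℝ)) * α * Real.log (α / beta K) := by
  have hK' : (3 : ℝ) ≤ K := by exact_mod_cast hK
  have hK0 : (0 : ℝ) < K := by linarith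
  have hk : (0 : ℝ) < (K : ℝ) - 1 := by linarith
  have hq := QInv_pos (show (2 : ℝ) < K by linarith)
  have hA0 : 0 < A := h0.trans_le hA
  refine J_small_le hK hc hcK h0 (hA.trans hA1) (M := M) ?_ ?_
  · refine le_trans ?_ hM
    gcongr
  · set q := QInv K
    set κ := 10 / (60 + 24 * M) with hκ
    have hκ0 : 0 ≤ κ := by positivity
    have hKi : 0 ≤ 1 - 1 / (K : ℝ) := by
      rw [sub_nonneg, div_le_one hK0]; linarith
    have e : ∀ y : ℝ, 1 + y - y / K = 1 + y * (1 - 1 / K) := fun y => by ring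
    rw [e] at hcond ⊢
    rw [e] at hcond
    have g1 : 1 + q * (1 - 1 / K) ≤ 1 + u * (1 - 1 / K) := by gcongr
    have g2 : (1 + l * (1 - 1 / K)) * l ^ 2 ≤ (1 + q * (1 - 1 / K)) * q ^ 2 := by gcongr
    have g3 : 1 + u * (1 - 1 / (K : ℝ)) ≤ K := by
      have : u * (1 - 1 / (K : ℝ)) ≤ K * (1 - 1 / K) := by gcongr
      have e3 : (K : ℝ) * (1 - 1 / K) = K - 1 := by field_simp
      linarith
    have g4 : κ * (α / ((K : ℝ) - 1)) * ((1 + l * (1 - 1 / K)) * l ^ 2)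
      ≤ κ * (α / ((K : ℝ) - 1)) * ((1 + q * (1 - 1 / K)) * q ^ 2) := by gcongr
    have g5 : (((K : ℝ) - 1) ^ 2 / K) * α * (1 + α / 2) ≤ (((K : ℝ) - 1) ^ 2 / K) * α * (1 + A / 2) := by
      gcongr
    have g6 := mul_le_mul_of_nonneg_left hcond (div_nonneg h0.le hA0.le)
    have g7 : α / A ≤ 1 := (div_le_one hA0).2 hA
    have g8 : 0 ≤ (1 - α / A) * (K - (1 + u * (1 - 1 / (K : ℝ)))) :=
      mul_nonneg (by linarith) (by linarith)
    have e1 : α / A * ((((K : ℝ) - 1) ^ 2 / K) * A * (1 + A / 2))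
      = (((K : ℝ) - 1) ^ 2 / K) * α * (1 + A / 2) := by field_simp
    have e2 : α / A * ((1 + l * (1 - 1 / K)) * κ * l ^ 2 * (A / ((K : ℝ) - 1)))
      = κ * (α / ((K : ℝ) - 1)) * ((1 + l * (1 - 1 / K)) * l ^ 2) := by field_simp
    linarith

theorem QInv_three_bounds : 2.14 ≤ QInv 3 ∧ QInv 3 ≤ 2.5 := by
  constructor
  · refine le_QInv (by norm_num) (by norm_num) ?_
    have := le_exp_div (p := 107) (n := 50) (q := 8.47) (by norm_num) (by norm_num)
    norm_num at this
    unfold expTwo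
    norm_num
    linarith
  · refine QInv_le (by norm_num) (by norm_num) ?_
    have := exp_div_le (p := 5) (n := 2) (q := 16) (by norm_num) (by norm_num) (by norm_num)
    norm_num at this
    unfold expTwo
    norm_num
    linarith

theorem QInv_four_bounds : 3.58 ≤ QInv 4 ∧ QInv 4 ≤ 3.6 := by
  constructor
  · refine le_QInv (by norm_num) (by norm_num) ?_
    have := le_exp_div (p := 179) (n := 50) (q := 35.3) (by norm_num) (by norm_num)
    norm_num at this
    unfold expTwo
    norm_num
    linarith
  · refine QInv_le (by norm_num) (by norm_num) ?_
    have := exp_div_le (p := 18) (n := 5) (q := 37) (by norm_num) (by norm_num) (by norm_num)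
    norm_num at this
    unfold expTwo
    norm_num
    linarith

theorem QInv_five_bounds : 4.75 ≤ QInv 5 ∧ QInv 5 ≤ 4.85 := by
  constructor
  · refine le_QInv (by norm_num) (by norm_num) ?_
    have := le_exp_div (p := 19) (n := 4) (q := 100) (by norm_num) (by norm_num)
    norm_num at this
    unfold expTwo
    norm_num
    linarith
  · refine QInv_le (by norm_num) (by norm_num) ?_
    have := exp_div_le (p := 97) (n := 20) (q := 150) (by norm_num) (by norm_num) (by norm_num)
    norm_num at this
    unfold expTwo
    norm_num
    linarith

theorem QInv_six_bounds : 5.85 ≤ QInv 6 ∧ QInv 6 ≤ 5.95 := by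
  constructor
  · refine le_QInv (by norm_num) (by norm_num) ?_
    have := le_exp_div (p := 117) (n := 20) (q := 300) (by norm_num) (by norm_num)
    norm_num at this
    unfold expTwo
    norm_num
    linarith
  · refine QInv_le (by norm_num) (by norm_num) ?_
    have := exp_div_le (p := 119) (n := 20) (q := 500) (by norm_num) (by norm_num) (by norm_num)
    norm_num at this
    unfold expTwo
    norm_num
    linarith

theorem le_QInv_seven : 6.9 ≤ QInv 7 := by
  refine le_QInv (by norm_num) (by norm_num) ?_
  have := le_exp_div (p := 69) (n := 10) (q := 800) (by norm_num) (by norm_num)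
  norm_num at this
  unfold expTwo
  norm_num
  linarith

theorem beta_three_le : beta 3 ≤ 1 / 8 := by
  refine beta_le_of_log (p := 51) (n := 20) (by norm_num) (by norm_num) ?_ (by norm_num)
  have := Real.log_two_gt_d9
  rw [log_beta_three]
  norm_num; linarith

theorem beta_four_le : beta 4 ≤ 0.156 := by
  refine beta_le_of_log (p := 93) (n := 50) (by norm_num) (by norm_num) ?_ (by norm_num)
  have := Real.log_three_gt_d9
  rw [log_beta_four]
  norm_num; linarith

theorem beta_five_le : beta 5 ≤ 0.181 := by
  refine beta_le_of_log (p := 171) (n := 100) (by norm_num) (by norm_num) ?_ (by norm_num)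
  have := Real.log_two_gt_d9
  rw [log_beta_five]
  norm_num; linarith

theorem beta_six_le : beta 6 ≤ 0.181 := by
  refine beta_le_of_log (p := 171) (n := 100) (by norm_num) (by norm_num) ?_ (by norm_num)
  have := Real.log_five_gt_d9
  rw [log_beta_six]
  norm_num; linarith

theorem beta_seven_le : beta 7 ≤ 0.181 := by
  refine beta_le_of_log (p := 171) (n := 100) (by norm_num) (by norm_num) ?_ (by norm_num)
  have := log_six_bounds.1
  rw [log_beta_seven]
  norm_num; linarith

theorem mul_beta_le_of_le_nine {K : ℕ} (h8 : 8 ≤ K) (h9 : K ≤ 9) :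
    ((K : ℝ) - 1) * beta K ≤ 1.35 := by
  have h8' : (8 : ℝ) ≤ K := by exact_mod_cast h8
  have h9' : (K : ℝ) ≤ 9 := by exact_mod_cast h9
  refine mul_beta_le (by omega) (p := 3) (n := 10) (by norm_num) (by norm_num) (by norm_num) ?_
  have h1 : Real.log 6 ≤ Real.log ((K : ℝ) - 1) := Real.log_le_log (by norm_num) (by linarith)
  have h2 := log_six_bounds.1
  have h3 : 0 ≤ 1 / ((K : ℝ) - 1) := one_div_nonneg.2 (by linarith)
  have h4 : 1 / 8 ≤ 1 / ((K : ℝ) - 1) := one_div_le_one_div_of_le (by linarith) (by linarith)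
  interval_cases K
  · norm_num at *; linarith
  · have h5 : Real.log 8 = 3 * Real.log 2 := by
      rw [← Real.log_rpow (by norm_num)]; norm_num
    have := Real.log_two_gt_d9
    norm_num at *; linarith

theorem mul_beta_le_of_le_twelve {K : ℕ} (h10 : 10 ≤ K) (h12 : K ≤ 12) :
    ((K : ℝ) - 1) * beta K ≤ 1.58 := by
  have h10' : (10 : ℝ) ≤ K := by exact_mod_cast h10
  have h12' : (K : ℝ) ≤ 12 := by exact_mod_cast h12
  refine mul_beta_le (by omega) (p := 9) (n := 20) (by norm_num) (by norm_num) (by norm_num) ?_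
  have h4 : 1 / 11 ≤ 1 / ((K : ℝ) - 1) := one_div_le_one_div_of_le (by linarith) (by linarith)
  have h5 := Real.log_ten_eq
  have h6 := Real.log_two_gt_d9
  have h7 := Real.log_five_gt_d9
  interval_cases K
  · have h5 : Real.log 9 = 2 * Real.log 3 := by
      rw [← Real.log_rpow (by norm_num)]; norm_num
    have := Real.log_three_gt_d9
    norm_num at *; linarith
  · norm_num at *; linarith
  · have : Real.log 10 ≤ Real.log 11 := Real.log_le_log (by norm_num) (by norm_num)
    norm_num at *; linarith

theorem mul_beta_le_exp {K : ℕ} (h3 : 3 ≤ K) : ((K : ℝ) - 1) * beta K ≤ 2.7183 := by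
  have h3' : (3 : ℝ) ≤ K := by exact_mod_cast h3
  refine mul_beta_le h3 (p := 1) (n := 1) (by norm_num) (by norm_num) (by norm_num) ?_
  have := Real.log_nonneg (show 1 ≤ (K : ℝ) - 1 by linarith)
  have h4 : 0 ≤ 1 / ((K : ℝ) - 1) := one_div_nonneg.2 (by linarith)
  rw [one_div] at h4
  norm_num
  linarith

theorem J_small_le_of_mul_le {K : ℕ} (hK : 8 ≤ K) {c α M b : ℝ} (hc : 2 < c) (hcK : c ≤ K)
    (h0 : 0 < α) (hb : ((K : ℝ) - 1) * α ≤ b) (hb3 : b ≤ ((K : ℝ) - 1) / 3)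
    (hM : (K : ℝ) ^ 2 * b ≤ M * ((K : ℝ) - 1) ^ 2)
    (hcond : ((K : ℝ) - 1) ^ 3 + ((K : ℝ) - 1) ^ 2 * (b / 2)
      ≤ K * (10 / (60 + 24 * M)) * ((K : ℝ) - 1 / 20) ^ 3) (hM0 : 0 ≤ M) :
    J K α (Real.sqrt (α / ((K : ℝ) - 1)), 1) c
      ≤ (1 / 2 - 1 / (K : ℝ)) * α * Real.log (α / beta K) := by
  have hK' : (8 : ℝ) ≤ K := by exact_mod_cast hK
  have hk : (0 : ℝ) < (K : ℝ) - 1 := by linarith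
  have hb0 : 0 < b := (mul_pos hk h0).trans_le hb
  -- With `u = K` the slack vanishes, and the quartic gain alone pays for the excess.
  refine J_small_le_of_bounds (A := b / ((K : ℝ) - 1)) (u := K) (l := K - 1 / 20) (M := M)
    (by omega) hc hcK h0 ?_ ?_ (by linarith) (sub_le_QInv hK') (QInv_lt (by linarith)).le
    ?_ ?_ hM0 le_rfl
  · rw [le_div_iff₀ hk]; linarith
  · rw [div_le_iff₀ hk]; linarith
  · rw [mul_div_assoc', div_le_iff₀ hk]; linarith
  · set κ := 10 / (60 + 24 * M) with hκ
    have hκ0 : 0 ≤ κ := by positivity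
    set l := (K : ℝ) - 1 / 20 with hl
    have hl1 : l ≤ 1 + l - l / K := by
      have : l / K ≤ 1 := by rw [div_le_one (by linarith), hl]; linarith
      linarith
    have hl0 : 0 ≤ l := by rw [hl]; linarith
    have e1 : (1 : ℝ) + K - K / K = K := by field_simp; ring
    rw [e1]
    have e2 : l * κ * l ^ 2 * (b / ((K : ℝ) - 1) / ((K : ℝ) - 1))
        ≤ (1 + l - l / K) * κ * l ^ 2 * (b / ((K : ℝ) - 1) / ((K : ℝ) - 1)) := by gcongr
    have e3 := mul_le_mul_of_nonneg_left hcond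
      (show 0 ≤ b / (K * ((K : ℝ) - 1) ^ 2) by positivity)
    have e4 : b / (K * ((K : ℝ) - 1) ^ 2) * (((K : ℝ) - 1) ^ 3 + ((K : ℝ) - 1) ^ 2 * (b / 2))
        = ((K : ℝ) - 1) ^ 2 / K * (b / ((K : ℝ) - 1)) * (1 + b / ((K : ℝ) - 1) / 2) := by
      field_simp
    have e5 : b / (K * ((K : ℝ) - 1) ^ 2) * (K * κ * l ^ 3)
        = l * κ * l ^ 2 * (b / ((K : ℝ) - 1) / ((K : ℝ) - 1)) := by
      field_simp
    rw [e4, e5] at e3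
    linarith

theorem J_sqrt_le {K : ℕ} (hK : 3 ≤ K) {c α : ℝ} (hc : 2 < c) (hcK : c ≤ K)
    (h0 : 0 < α) (hα : α ≤ beta K) :
    J K α (Real.sqrt (α / ((K : ℝ) - 1)), 1) c
      ≤ (1 / 2 - 1 / (K : ℝ)) * α * Real.log (α / beta K) := by
  have hK' : (3 : ℝ) ≤ K := by exact_mod_cast hK
  have hmul : ((K : ℝ) - 1) * α ≤ ((K : ℝ) - 1) * beta K :=
    mul_le_mul_of_nonneg_left hα (by linarith)
  rcases lt_or_ge K 8 with h8 | h8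
  · interval_cases K
    · have hq := QInv_three_bounds
      refine J_small_le_of_bounds (A := 1 / 8) (u := 2.5) (l := 2.14) (M := 1) hK hc hcK h0
        (hα.trans beta_three_le) ?_ ?_ ?_ ?_ ?_ ?_ ?_ ?_ <;> norm_num <;> norm_num at hq <;>
        linarith [hq.1, hq.2]
    · have hq := QInv_four_bounds
      refine J_small_le_of_bounds (A := 0.156) (u := 3.6) (l := 3.58) (M := 0.68) hK hc hcK h0
        (hα.trans beta_four_le) ?_ ?_ ?_ ?_ ?_ ?_ ?_ ?_ <;> norm_num <;> norm_num at hq <;>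
        linarith [hq.1, hq.2]
    · have hq := QInv_five_bounds
      refine J_small_le_of_bounds (A := 0.181) (u := 4.85) (l := 4.75) (M := 1.07) hK hc hcK h0
        (hα.trans beta_five_le) ?_ ?_ ?_ ?_ ?_ ?_ ?_ ?_ <;> norm_num <;> norm_num at hq <;>
        linarith [hq.1, hq.2]
    · have hq := QInv_six_bounds
      refine J_small_le_of_bounds (A := 0.181) (u := 5.95) (l := 5.85) (M := 1.282) hK hc hcK h0
        (hα.trans beta_six_le) ?_ ?_ ?_ ?_ ?_ ?_ ?_ ?_ <;> norm_num <;> norm_num at hq <;>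
        linarith [hq.1, hq.2]
    · have hq := le_QInv_seven
      have hq2 := QInv_lt (c := 7) (by norm_num)
      refine J_small_le_of_bounds (A := 0.181) (u := 7) (l := 6.9) (M := 1.479) hK hc hcK h0
        (hα.trans beta_seven_le) ?_ ?_ ?_ ?_ ?_ ?_ ?_ ?_ <;> norm_num <;> norm_num at hq <;>
        linarith
  rcases lt_or_ge K 10 with h10 | h10
  · have hb := hmul.trans (mul_beta_le_of_le_nine h8 (by omega))
    refine J_small_le_of_mul_le (b := 1.35) (M := 1.764) h8 hc hcK h0 hb ?_ ?_ ?_ ?_ <;>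
      interval_cases K <;> norm_num
  rcases lt_or_ge K 13 with h13 | h13
  · have hb := hmul.trans (mul_beta_le_of_le_twelve h10 (by omega))
    refine J_small_le_of_mul_le (b := 1.58) (M := 1.96) h8 hc hcK h0 hb ?_ ?_ ?_ ?_ <;>
      interval_cases K <;> norm_num
  · have hb := hmul.trans (mul_beta_le_exp hK)
    have h13' : (13 : ℝ) ≤ K := by exact_mod_cast h13
    -- The shift makes the conditions polynomial inequalities in `j ≥ 0`.
    obtain ⟨j, hj0, hj⟩ : ∃ j : ℝ, 0 ≤ j ∧ (K : ℝ) = 13 + j := ⟨K - 13, by linarith, by ring⟩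
    refine J_small_le_of_mul_le (b := 2.7183) (M := 3.2) h8 hc hcK h0 hb ?_ ?_ ?_ ?_
    · linarith
    · rw [hj]; norm_num; nlinarith
    · rw [hj]; norm_num; linarith [pow_nonneg hj0 2, pow_nonneg hj0 3, pow_nonneg hj0 4]
    · norm_num

/-! ### Entropy and `exp₂` estimates for the middle range `α = (1-x)/2`. -/

/-- The entropy deficit `2 (ln 2 - H((1 - x) / 2))`. -/
noncomputable def deficit (x : ℝ) : ℝ :=
  (1 + x) * Real.log (1 + x) + (1 - x) * Real.log (1 - x)

theorem H_eq_deficit {x : ℝ} (hx0 : 0 < x) (hx1 : x < 1) :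
    H ((1 - x) / 2) = Real.log 2 - deficit x / 2 := by
  have h1 : 1 - (1 - x) / 2 = (1 + x) / 2 := by ring
  unfold H deficit
  rw [h1, Real.log_div (by linarith) (by norm_num), Real.log_div (by linarith) (by norm_num)]
  ring

theorem hasDerivAt_log_one_add {x : ℝ} (hx : 0 ≤ x) :
    HasDerivAt (fun x : ℝ => Real.log (1 + x)) (1 / (1 + x)) x :=
  (((hasDerivAt_id x).const_add 1).log (by simp only [id]; linarith)).congr_deriv (by simp)

theorem hasDerivAt_log_one_sub {x : ℝ} (hx : x < 1) :
    HasDerivAt (fun x : ℝ => Real.log (1 - x)) (-1 / (1 - x)) x :=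
  (((hasDerivAt_id x).const_sub 1).log (by simp only [id]; linarith)).congr_deriv (by simp)

theorem hasDerivAt_log_one_add_sub_log_one_sub {x : ℝ} (hx0 : 0 ≤ x) (hx1 : x < 1) :
    HasDerivAt (fun x : ℝ => Real.log (1 + x) - Real.log (1 - x)) (2 / (1 - x ^ 2)) x := by
  have h1 : 1 + x ≠ 0 := by linarith
  have h2 : 1 - x ≠ 0 := by linarith
  have h3 : 1 - x ^ 2 ≠ 0 := by
    have : 1 - x ^ 2 = (1 + x) * (1 - x) := by ring
    rw [this]; exact mul_ne_zero h1 h2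
  refine ((hasDerivAt_log_one_add hx0).sub (hasDerivAt_log_one_sub hx1)).congr_deriv ?_
  field_simp
  ring

theorem hasDerivAt_deficit {x : ℝ} (hx0 : 0 ≤ x) (hx1 : x < 1) :
    HasDerivAt deficit (Real.log (1 + x) - Real.log (1 - x)) x := by
  have h1 : 1 + x ≠ 0 := by linarith
  have h2 : 1 - x ≠ 0 := by linarith
  refine ((((hasDerivAt_id x).const_add 1).mul (hasDerivAt_log_one_add hx0)).add
    (((hasDerivAt_id x).const_sub 1).mul (hasDerivAt_log_one_sub hx1))).congr_deriv ?_
  simp only [id]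
  field_simp
  ring

theorem le_log_one_add_sub_log_one_sub {x : ℝ} (hx0 : 0 ≤ x) (hx1 : x < 1) :
    2 * x + 2 / 3 * x ^ 3 + 2 / 5 * x ^ 5 ≤ Real.log (1 + x) - Real.log (1 - x) := by
  have := nonneg_of_hasDerivAt_nonneg
    (f := fun t => (Real.log (1 + t) - Real.log (1 - t))
      - (2 * t + 2 / 3 * t ^ 3 + 2 / 5 * t ^ 5))
    (f' := fun t => 2 / (1 - t ^ 2) - (2 + 2 * t ^ 2 + 2 * t ^ 4)) hx0
    (fun t ht => ((hasDerivAt_log_one_add_sub_log_one_sub ht.1 (ht.2.trans_lt hx1)).sub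
      ((((hasDerivAt_id t).const_mul 2).add (((hasDerivAt_id t).pow 3).const_mul (2 / 3))).add
        (((hasDerivAt_id t).pow 5).const_mul (2 / 5)))).congr_deriv (by simp; ring))
    (fun t ht => by
      have h : 0 < 1 - t ^ 2 := by nlinarith [ht.1, ht.2]
      rw [sub_nonneg, le_div_iff₀ h]
      nlinarith [pow_nonneg ht.1.le 6]) (by simp)
  linarith

theorem le_deficit {x : ℝ} (hx0 : 0 ≤ x) (hx1 : x < 1) :
    x ^ 2 + x ^ 4 / 6 ≤ deficit x := by
  have := nonneg_of_hasDerivAt_nonneg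
    (f := fun t => deficit t - (t ^ 2 + t ^ 4 / 6))
    (f' := fun t => (Real.log (1 + t) - Real.log (1 - t)) - (2 * t + 2 / 3 * t ^ 3)) hx0
    (fun t ht => ((hasDerivAt_deficit ht.1 (ht.2.trans_lt hx1)).sub
      (((hasDerivAt_id t).pow 2).add (((hasDerivAt_id t).pow 4).div_const 6))).congr_deriv
      (by simp; ring))
    (fun t ht => by
      have := le_log_one_add_sub_log_one_sub ht.1.le (ht.2.trans hx1)
      have := pow_nonneg ht.1.le 5
      linarith) (by simp [deficit])
  linarith

/-- The last coefficient absorbs the Taylor tail: `9 * 0.802 = 7.218` exceeds `2 / (1 - 0.85²)`. -/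
theorem log_one_add_sub_log_one_sub_le {x : ℝ} (hx0 : 0 ≤ x) (hx1 : x ≤ 0.85) :
    Real.log (1 + x) - Real.log (1 - x)
      ≤ 2 * x + 2 / 3 * x ^ 3 + 2 / 5 * x ^ 5 + 2 / 7 * x ^ 7 + 0.802 * x ^ 9 := by
  have := nonneg_of_hasDerivAt_nonneg
    (f := fun t => (2 * t + 2 / 3 * t ^ 3 + 2 / 5 * t ^ 5 + 2 / 7 * t ^ 7 + 0.802 * t ^ 9)
      - (Real.log (1 + t) - Real.log (1 - t)))
    (f' := fun t => (2 + 2 * t ^ 2 + 2 * t ^ 4 + 2 * t ^ 6 + 7.218 * t ^ 8) - 2 / (1 - t ^ 2)) hx0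
    (fun t ht => ((((((hasDerivAt_id t).const_mul 2).add
        (((hasDerivAt_id t).pow 3).const_mul (2 / 3))).add
        (((hasDerivAt_id t).pow 5).const_mul (2 / 5))).add
        (((hasDerivAt_id t).pow 7).const_mul (2 / 7))).add
        (((hasDerivAt_id t).pow 9).const_mul 0.802)).sub
        (hasDerivAt_log_one_add_sub_log_one_sub ht.1
          (by linarith [ht.2.trans hx1])) |>.congr_deriv (by simp; ring))
    (fun t ht => by
      have ht2 : t ^ 2 ≤ 0.7225 := by nlinarith [ht.1, ht.2]
      have h : 0 < 1 - t ^ 2 := by linarith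
      rw [sub_nonneg, div_le_iff₀ h]
      have := mul_nonneg (pow_nonneg ht.1.le 8) (by linarith : 0 ≤ 7.218 * (1 - t ^ 2) - 2)
      nlinarith) (by simp)
  linarith

theorem deficit_le {x : ℝ} (hx0 : 0 ≤ x) (hx1 : x ≤ 0.85) :
    deficit x ≤ x ^ 2 + x ^ 4 / 6 + x ^ 6 / 15 + x ^ 8 / 28 + 0.0802 * x ^ 10 := by
  have := nonneg_of_hasDerivAt_nonneg
    (f := fun t => (t ^ 2 + t ^ 4 / 6 + t ^ 6 / 15 + t ^ 8 / 28 + 0.0802 * t ^ 10) - deficit t)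
    (f' := fun t => (2 * t + 2 / 3 * t ^ 3 + 2 / 5 * t ^ 5 + 2 / 7 * t ^ 7 + 0.802 * t ^ 9)
      - (Real.log (1 + t) - Real.log (1 - t))) hx0
    (fun t ht => ((((((hasDerivAt_id t).pow 2).add
        (((hasDerivAt_id t).pow 4).div_const 6)).add
        (((hasDerivAt_id t).pow 6).div_const 15)).add
        (((hasDerivAt_id t).pow 8).div_const 28)).add
        (((hasDerivAt_id t).pow 10).const_mul 0.0802)).sub
        (hasDerivAt_deficit ht.1 (by linarith [ht.2.trans hx1])) |>.congr_deriv (by simp; ring))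
    (fun t ht => sub_nonneg.2 (log_one_add_sub_log_one_sub_le ht.1.le (ht.2.le.trans hx1)))
    (by simp [deficit])
  linarith

/-- The right side is the cross-entropy term of `mul_J_center_le` for `K = 3` and `x = 4y/3`. -/
theorem le_three_halves_log_add {y : ℝ} (hy0 : 0 ≤ y) (hy1 : y < 1) :
    5 / 2 * y ^ 2 + 7 / 12 * y ^ 4 + 3 / 10 * y ^ 6
      ≤ 3 / 2 * (Real.log (1 + y) + Real.log (1 - y))
        + 2 * y * (Real.log (1 + y) - Real.log (1 - y)) := by
  have := nonneg_of_hasDerivAt_nonneg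
    (f := fun t => 3 / 2 * (Real.log (1 + t) + Real.log (1 - t))
        + 2 * t * (Real.log (1 + t) - Real.log (1 - t))
        - (5 / 2 * t ^ 2 + 7 / 12 * t ^ 4 + 3 / 10 * t ^ 6))
    (f' := fun t => t / (1 - t ^ 2) + 2 * (Real.log (1 + t) - Real.log (1 - t))
      - (5 * t + 7 / 3 * t ^ 3 + 9 / 5 * t ^ 5)) hy0
    (fun t ht => by
      have ht1 := ht.2.trans_lt hy1
      have h1 : 1 + t ≠ 0 := by linarith [ht.1]
      have h2 : 1 - t ≠ 0 := by linarith
      have h3 : 1 - t ^ 2 = (1 + t) * (1 - t) := by ring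
      refine (((((hasDerivAt_log_one_add ht.1).add (hasDerivAt_log_one_sub ht1)).const_mul
        (3 / 2)).add (((hasDerivAt_id t).const_mul 2).mul
          (hasDerivAt_log_one_add_sub_log_one_sub ht.1 ht1))).sub
          (((((hasDerivAt_id t).pow 2).const_mul (5 / 2)).add
          (((hasDerivAt_id t).pow 4).const_mul (7 / 12))).add
          (((hasDerivAt_id t).pow 6).const_mul (3 / 10)))).congr_deriv ?_
      simp only [id, h3]
      field_simp
      simp
      ring)
    (fun t ht => by
      have h : 0 < 1 - t ^ 2 := by nlinarith [ht.1, ht.2]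
      have h1 := le_log_one_add_sub_log_one_sub ht.1.le (ht.2.trans hy1)
      have h2 : t + t ^ 3 + t ^ 5 ≤ t / (1 - t ^ 2) := by
        rw [le_div_iff₀ h]
        nlinarith [pow_nonneg ht.1.le 7]
      linarith) (by simp)
  linarith

theorem log_one_add_le {r : ℝ} (hr : 0 ≤ r) : Real.log (1 + r) ≤ r - r ^ 2 / 2 + r ^ 3 / 3 := by
  have := nonneg_of_hasDerivAt_nonneg
    (f := fun t => t - t ^ 2 / 2 + t ^ 3 / 3 - Real.log (1 + t))
    (f' := fun t => 1 - t + t ^ 2 - 1 / (1 + t)) hr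
    (fun t ht => (((hasDerivAt_id t).sub (((hasDerivAt_id t).pow 2).div_const 2)).add
      (((hasDerivAt_id t).pow 3).div_const 3)).sub (hasDerivAt_log_one_add ht.1)
      |>.congr_deriv (by simp))
    (fun t ht => by
      have h : 0 < 1 + t := by linarith [ht.1]
      rw [sub_nonneg, div_le_iff₀ h]
      nlinarith [pow_nonneg ht.1.le 3]) (by simp)
  linarith

/-- The function `exp₂(z) / z²` is increasing because its logarithmic derivative is `(Q z - 2) / z >
0`. -/
theorem expTwo_mul_le_sq {l x y : ℝ} (hl : 0 < l) (hx : 0 < x) (hxy : x ≤ y) :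
    expTwo (l * x) ≤ (x / y) ^ 2 * expTwo (l * y) := by
  have hy : 0 < y := hx.trans_le hxy
  have hm : MonotoneOn (fun z => Real.log (expTwo z) - 2 * Real.log z) (Ioi 0) := by
    have hd : ∀ z ∈ Ioi (0 : ℝ), HasDerivAt (fun z => Real.log (expTwo z) - 2 * Real.log z)
        ((Q z - 2) / z) z := fun z hz =>
      ((hasDerivAt_log_expTwo hz).sub ((Real.hasDerivAt_log (ne_of_gt hz)).const_mul 2)).congr_deriv
        (by ring)
    refine monotoneOn_of_deriv_nonneg (convex_Ioi 0)
      (fun z hz => (hd z hz).continuousAt.continuousWithinAt)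
      (fun z hz => (hd z (interior_subset hz)).differentiableAt.differentiableWithinAt) ?_
    intro z hz
    rw [interior_Ioi] at hz
    rw [(hd z hz).deriv]
    exact div_nonneg (by linarith [two_lt_Q hz]) (le_of_lt hz)
  have h := hm (mul_pos hl hx) (mul_pos hl hy) (mul_le_mul_of_nonneg_left hxy hl.le)
  have p1 := expTwo_pos (mul_pos hl hx).ne'
  have p2 := expTwo_pos (mul_pos hl hy).ne'
  simp only [Real.log_mul hl.ne' hx.ne', Real.log_mul hl.ne' hy.ne'] at h
  rw [← Real.log_le_log_iff p1 (by positivity), Real.log_mul (by positivity) p2.ne',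
    Real.log_pow, Real.log_div hx.ne' hy.ne']
  push_cast
  linarith

theorem expTwo_mul_le_exp {l x : ℝ} (hl : 0 ≤ l) (hx0 : 0 ≤ x) (hx1 : x ≤ 1) :
    expTwo (l * x) ≤ Real.exp (-(l * (1 - x))) * expTwo l := by
  have h1 := Real.add_one_le_exp (l * (1 - x))
  have h2 : Real.exp (l * x) = Real.exp l * Real.exp (-(l * (1 - x))) := by
    rw [← Real.exp_add]; ring_nf
  have h3 : Real.exp (l * (1 - x)) * Real.exp (-(l * (1 - x))) = 1 := by
    rw [← Real.exp_add]; simp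
  have h4 := Real.exp_pos (-(l * (1 - x)))
  unfold expTwo
  rw [h2]
  have h5 : 1 + l ≤ (1 + l * x) * Real.exp (l * (1 - x)) := by
    have : 0 ≤ l * x := mul_nonneg hl hx0
    have h6 : 0 ≤ (l * x) * (l * (1 - x)) := mul_nonneg this (mul_nonneg hl (by linarith))
    nlinarith
  have h7 := mul_le_mul_of_nonneg_right h5 h4.le
  rw [mul_assoc, h3] at h7
  linarith

/-- As `ζ₁ + ζ₂ = 1`, one summand of the generating function is `exp₂(λ)` itself; after passing to
`c = K` the `log 2` from `H` cancels the one from the mean. -/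
theorem mul_J_center_le {K : ℕ} (hK : 3 ≤ K) {c x y : ℝ} (hc : 2 < c) (hcK : c ≤ K)
    (hx0 : 0 < x) (hx1 : x < 1) (hy0 : 0 < y) (hy1 : y < 1) :
    K * J K ((1 - x) / 2) ((1 - y) / 2, (1 + y) / 2) c
      ≤ -deficit x / 2 + K / 2 * (deficit x
          - ((1 - x) * Real.log (1 - y) + (1 + x) * Real.log (1 + y)))
        + Real.log (1 + expTwo (QInv K * y) / expTwo (QInv K)) := by
  have hK' : (3 : ℝ) ≤ K := by exact_mod_cast hK
  have hK2 : (2 : ℝ) < K := by linarith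
  have hK0 : (0 : ℝ) < K := by linarith
  have hm := log_expTwo_mean_mono (a := 1) (b := y) (QInv_pos hc)
    (strictMonoOn_QInv.monotoneOn hc hK2 hcK) one_pos hy0
  rw [Q_QInv hc, Q_QInv hK2] at hm
  have hq := QInv_pos hK2
  have h2 := expTwo_pos hq.ne'
  have h3 := expTwo_pos (mul_pos hq hy0).ne'
  have hlog : Real.log ((expTwo (QInv K * 1) + expTwo (QInv K * y)) / (2 * expTwo (QInv K)))
      = Real.log (1 + expTwo (QInv K * y) / expTwo (QInv K)) - Real.log 2 := by
    rw [← Real.log_div (by positivity) two_ne_zero, mul_one]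
    congr 1
    field_simp
  rw [hlog] at hm
  have e1 : (1 + y) / 2 + (1 - y) / 2 = 1 := by ring
  have e2 : (1 + y) / 2 - (1 - y) / 2 = y := by ring
  have e3 : 1 - (1 - x) / 2 = (1 + x) / 2 := by ring
  have e4 : (1 - x) / 2 / ((1 - y) / 2) = (1 - x) / (1 - y) := by
    field_simp
  have e5 : (1 + x) / 2 / ((1 + y) / 2) = (1 + x) / (1 + y) := by
    field_simp
  unfold J
  simp only
  rw [e1, e2, e3, e4, e5, H_eq_deficit hx0 hx1, Real.log_div (by linarith) (by linarith),
    Real.log_div (by linarith) (by linarith)]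
  have hm' := mul_le_mul_of_nonneg_left hm hK0.le
  set S := Real.log ((expTwo (QInv c * 1) + expTwo (QInv c * y)) / (2 * expTwo (QInv c)))
  set R := Real.log (1 + expTwo (QInv K * y) / expTwo (QInv K))
  have e6 : (K : ℝ) * (1 / K * (R - Real.log 2)) = R - Real.log 2 := by field_simp
  have e7 : (K : ℝ) * (1 / K * (Real.log 2 - deficit x / 2)) = Real.log 2 - deficit x / 2 := by
    field_simp
  rw [e6] at hm'
  rw [mul_add, mul_add, mul_add, e7]
  refine (add_le_add_right hm' _).trans (le_of_eq ?_)
  unfold deficit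
  ring

theorem J_diagonal_neg {K : ℕ} (hK : 3 ≤ K) {c x : ℝ} (hc : 2 < c) (hcK : c ≤ K)
    (hx0 : 0 < x) (hx1 : x < 1)
    (h : Real.log (1 + expTwo (QInv K * x) / expTwo (QInv K)) < deficit x / 2) :
    J K ((1 - x) / 2) ((1 - x) / 2, (1 + x) / 2) c < 0 := by
  have hm := mul_J_center_le hK hc hcK hx0 hx1 hx0 hx1
  have hK0 : (0 : ℝ) < K := by exact_mod_cast (by omega : 0 < K)
  have e : deficit x - ((1 - x) * Real.log (1 - x) + (1 + x) * Real.log (1 + x)) = 0 := by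
    unfold deficit; ring
  rw [e, mul_zero, add_zero] at hm
  by_contra hJ
  have := mul_nonneg hK0.le (not_lt.1 hJ)
  linarith

/-- One check at the endpoint `y` suffices: quadratic scaling gives a ratio `r ≤ x²/2` for all `x ≤
y`, and then `log (1 + r) < r ≤ x²/2 ≤ deficit x / 2`. -/
theorem J_diagonal_neg_of_exp_le {K : ℕ} (hK : 3 ≤ K) {c x y : ℝ} (hc : 2 < c) (hcK : c ≤ K)
    (hx0 : 0 < x) (hxy : x ≤ y) (hy1 : y < 1)
    (h : Real.exp (-(QInv K * (1 - y))) ≤ y ^ 2 / 2) :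
    J K ((1 - x) / 2) ((1 - x) / 2, (1 + x) / 2) c < 0 := by
  have hK' : (3 : ℝ) ≤ K := by exact_mod_cast hK
  have hq := QInv_pos (show (2 : ℝ) < K by linarith)
  have hy0 : 0 < y := hx0.trans_le hxy
  refine J_diagonal_neg hK hc hcK hx0 (hxy.trans_lt hy1) ?_
  have h2 := expTwo_pos hq.ne'
  have hr : expTwo (QInv K * x) / expTwo (QInv K) ≤ x ^ 2 / 2 := by
    rw [div_le_iff₀ h2]
    calc expTwo (QInv K * x) ≤ (x / y) ^ 2 * expTwo (QInv K * y) := expTwo_mul_le_sq hq hx0 hxy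
      _ ≤ (x / y) ^ 2 * (Real.exp (-(QInv K * (1 - y))) * expTwo (QInv K)) := by
        gcongr; exact expTwo_mul_le_exp hq.le hy0.le hy1.le
      _ ≤ (x / y) ^ 2 * (y ^ 2 / 2 * expTwo (QInv K)) := by gcongr
      _ = x ^ 2 / 2 * expTwo (QInv K) := by field_simp
  have hr0 : 0 < expTwo (QInv K * x) / expTwo (QInv K) :=
    div_pos (expTwo_pos (mul_pos hq hx0).ne') h2
  have hlog := Real.log_lt_sub_one_of_pos (x := 1 + expTwo (QInv K * x) / expTwo (QInv K))
    (by linarith) (by linarith)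
  have := le_deficit hx0.le (hxy.trans_lt hy1)
  have := pow_pos hx0 4
  linarith

/-! ### Negativity of `J` in the middle range, by size of `K`. -/

theorem one_le_mul_beta {K : ℕ} (hK : 6 ≤ K) : 1 / (K : ℝ) ≤ 0.99 * beta K := by
  have hK' : (6 : ℝ) ≤ K := by exact_mod_cast hK
  have hk : (0 : ℝ) < (K : ℝ) - 1 := by linarith
  have hk2 : (0 : ℝ) < (K : ℝ) - 2 := by linarith
  have hL : Real.log ((K : ℝ) - 1) ≤ Real.log 5 + (((K : ℝ) - 1) / 5 - 1) := by
    have h := Real.log_le_sub_one_of_pos (x := ((K : ℝ) - 1) / 5) (by positivity)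
    rw [Real.log_div hk.ne' (by norm_num)] at h
    linarith
  have hL5 := Real.log_five_lt_d9
  have hpos : 0 < ((K : ℝ) - 1) * beta K := mul_pos hk (beta_pos K)
  have hexp := Real.add_one_le_exp (Real.log (((K : ℝ) - 1) * beta K))
  rw [Real.exp_log hpos, log_mul_beta (by omega)] at hexp
  have hi : 1 / ((K : ℝ) - 1) ≤ 1 / 5 := one_div_le_one_div_of_le (by norm_num) (by linarith)
  have h1 : (2 * Real.log ((K : ℝ) - 1) + 1 + 1 / ((K : ℝ) - 1)) / ((K : ℝ) - 2)
      ≤ 2 - 100 / 99 * (1 - 1 / K) := by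
    rw [div_le_iff₀ hk2]
    have e : (2 - 100 / 99 * (1 - 1 / (K : ℝ))) * ((K : ℝ) - 2)
        = 98 / 99 * ((K : ℝ) - 2) + 100 / 99 * (1 - 2 / K) := by
      field_simp; ring
    have hi2 : 2 / (K : ℝ) ≤ 1 / 3 := by
      rw [div_le_iff₀ (by linarith)]; linarith
    rw [e]
    linarith
  have h2 : 100 / 99 * (1 - 1 / (K : ℝ)) ≤ ((K : ℝ) - 1) * beta K := by linarith
  have e : 100 / 99 * (1 - 1 / (K : ℝ)) = ((K : ℝ) - 1) * (100 / 99 * (1 / K)) := by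
    field_simp
  rw [e] at h2
  have := le_of_mul_le_mul_left h2 hk
  linarith

theorem J_diagonal_neg_of_six_le {K : ℕ} (hK : 6 ≤ K) {c x : ℝ} (hc : 2 < c) (hcK : c ≤ K)
    (hx0 : 0 < x) (hx : 0.99 * beta K ≤ (1 - x) / 2) :
    J K ((1 - x) / 2) ((1 - x) / 2, (1 + x) / 2) c < 0 := by
  have hK' : (6 : ℝ) ≤ K := by exact_mod_cast hK
  have hb := (one_le_mul_beta hK).trans hx
  have hKi : 1 / (K : ℝ) ≤ 1 / 6 := one_div_le_one_div_of_le (by norm_num) hK'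
  have hKi0 : 0 < 1 / (K : ℝ) := by positivity
  -- Here `y` corresponds to `α = 1/K ≤ 0.99 β_K`. The condition follows from `e^(-1.9) ≤ 2/9 = (1 -
  -- 2/6)²/2`.
  refine J_diagonal_neg_of_exp_le (by omega) hc hcK hx0 (y := 1 - 2 / K) ?_ ?_ ?_
  · have : 2 / (K : ℝ) = 2 * (1 / K) := by ring
    linarith
  · have : 2 / (K : ℝ) = 2 * (1 / K) := by ring
    linarith
  · have h1 : 19 / 10 ≤ QInv K * (1 - (1 - 2 / (K : ℝ))) := by
      have e : QInv K * (1 - (1 - 2 / (K : ℝ))) = QInv K * 2 / K := by ring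
      rw [e, le_div_iff₀ (by linarith)]
      rcases lt_or_ge K 8 with h8 | h8
      · interval_cases K
        · have := QInv_six_bounds.1
          norm_num at *; linarith
        · have := le_QInv_seven
          norm_num at *; linarith
      · have h8' : (8 : ℝ) ≤ K := by exact_mod_cast h8
        have := sub_le_QInv h8'
        linarith
    have h2 : Real.exp (-(QInv K * (1 - (1 - 2 / (K : ℝ))))) ≤ 2 / 9 := by
      refine (Real.exp_le_exp.2 (neg_le_neg h1)).trans ?_
      rw [Real.exp_neg]
      refine inv_le_of_inv_le₀ (by norm_num) ?_
      have := le_exp_div (p := 19) (n := 10) (q := 9 / 2) (by norm_num) (by norm_num)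
      norm_num at this ⊢
      linarith
    have e : 2 / (K : ℝ) = 2 * (1 / K) := by ring
    refine h2.trans ?_
    rw [e]
    nlinarith

theorem le_beta_three : 0.075 ≤ 0.99 * beta 3 := by
  have : 0.07576 ≤ beta 3 := by
    refine le_beta_of_log (p := 129) (n := 50) (by norm_num) (by norm_num) ?_ (by norm_num)
    have := Real.log_two_lt_d9
    rw [log_beta_three]
    norm_num; linarith
  linarith

theorem le_beta_four : 0.153 ≤ 0.99 * beta 4 := by
  have : 0.1546 ≤ beta 4 := by
    refine le_beta_of_log (p := 28) (n := 15) (by norm_num) (by norm_num) ?_ (by norm_num)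
    have := Real.log_three_lt_d9
    rw [log_beta_four]
    norm_num; linarith
  linarith

theorem le_beta_five : 0.175 ≤ 0.99 * beta 5 := by
  have : 0.1769 ≤ beta 5 := by
    refine le_beta_of_log (p := 173) (n := 100) (by norm_num) (by norm_num) ?_ (by norm_num)
    have := Real.log_two_lt_d9
    rw [log_beta_five]
    norm_num; linarith
  linarith

theorem J_diagonal_neg_five {c x : ℝ} (hc : 2 < c) (hcK : c ≤ 5)
    (hx0 : 0 < x) (hx : 0.99 * beta 5 ≤ (1 - x) / 2) :
    J 5 ((1 - x) / 2) ((1 - x) / 2, (1 + x) / 2) c < 0 := by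
  have hb := le_beta_five.trans hx
  refine J_diagonal_neg_of_exp_le (by norm_num) hc (by exact_mod_cast hcK) hx0 (y := 0.65)
    (by linarith) (by norm_num) ?_
  have hq := QInv_five_bounds.1
  have h1 : -(QInv (5 : ℕ) * (1 - 0.65)) ≤ -(83 / 50 : ℝ) := by
    norm_num at hq ⊢; linarith
  refine (Real.exp_le_exp.2 h1).trans ?_
  rw [Real.exp_neg]
  refine inv_le_of_inv_le₀ (by norm_num) ?_
  have := le_exp_div (p := 83) (n := 50) (q := 5) (by norm_num) (by norm_num)
  norm_num at this ⊢
  linarith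

theorem expTwo_mono {u v : ℝ} (hu : 0 ≤ u) (huv : u ≤ v) : expTwo u ≤ expTwo v := by
  have : MonotoneOn expTwo (Ici 0) := by
    refine monotoneOn_of_deriv_nonneg (convex_Ici 0) continuous_expTwo.continuousOn
      (fun z _ => (hasDerivAt_expTwo z).differentiableAt.differentiableWithinAt) ?_
    intro z hz
    rw [interior_Ici] at hz
    rw [(hasDerivAt_expTwo z).deriv]
    exact (exp_sub_one_pos hz).le
  exact this hu (hu.trans huv) huv

theorem le_expTwo_QInv_four : 31.2 ≤ expTwo (QInv 4) := by
  refine le_trans ?_ (expTwo_mono (by norm_num) QInv_four_bounds.1)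
  have := le_exp_div (p := 179) (n := 50) (q := 35.8) (by norm_num) (by norm_num)
  norm_num at this
  unfold expTwo
  norm_num
  linarith

theorem expTwo_ratio_four_le {x y E : ℝ} (hx0 : 0 < x) (hxy : x ≤ y)
    (hE : Real.exp (3.6 * y) ≤ E) :
    expTwo (QInv 4 * x) / expTwo (QInv 4) ≤ (x / y) ^ 2 * ((E - 1 - 3.6 * y) / 31.2) := by
  have hq : 0 < QInv 4 := by linarith [QInv_four_bounds.1]
  have hy : 0 < y := hx0.trans_le hxy
  have h1 : expTwo (QInv 4 * y) ≤ E - 1 - 3.6 * y := by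
    refine (expTwo_mono (mul_pos hq hy).le
      (mul_le_mul_of_nonneg_right QInv_four_bounds.2 hy.le)).trans ?_
    unfold expTwo; linarith
  have h2 := le_expTwo_QInv_four
  have h3 : 0 ≤ expTwo (QInv 4 * y) := expTwo_nonneg _
  calc expTwo (QInv 4 * x) / expTwo (QInv 4)
      ≤ (x / y) ^ 2 * expTwo (QInv 4 * y) / expTwo (QInv 4) := by
        gcongr
        exact expTwo_mul_le_sq hq hx0 hxy
    _ ≤ (x / y) ^ 2 * (E - 1 - 3.6 * y) / 31.2 := by
        have := h3.trans h1
        gcongr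
    _ = _ := by ring

/-- For `x ≤ 0.6` the bound `log (1 + r) < r` suffices. Up to `0.694 = 1 - 2 * 0.153` the ratio
bound is `0.579 x²`, so the cubic bound on `log (1 + r)` and the quartic term of the deficit are
needed. -/
theorem J_diagonal_neg_four {c x : ℝ} (hc : 2 < c) (hcK : c ≤ 4)
    (hx0 : 0 < x) (hx : 0.99 * beta 4 ≤ (1 - x) / 2) :
    J 4 ((1 - x) / 2) ((1 - x) / 2, (1 + x) / 2) c < 0 := by
  have hb := le_beta_four.trans hx
  have hx1 : x ≤ 0.694 := by linarith
  refine J_diagonal_neg (by norm_num) hc (by exact_mod_cast hcK) hx0 (by linarith) ?_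
  have hd := le_deficit hx0.le (by linarith)
  have hq : 0 < QInv 4 := by linarith [QInv_four_bounds.1]
  have hr0 : 0 < expTwo (QInv 4 * x) / expTwo (QInv 4) :=
    div_pos (expTwo_pos (mul_pos hq hx0).ne') (expTwo_pos hq.ne')
  rcases le_total x 0.6 with h6 | h6
  · have hE := exp_div_le (p := 54) (n := 25) (q := 8.7) (by norm_num) (by norm_num) (by norm_num)
    have hr := expTwo_ratio_four_le hx0 h6 (E := 8.7) (by norm_num at hE ⊢; linarith)
    have hlog := Real.log_lt_sub_one_of_pos (x := 1 + expTwo (QInv 4 * x) / expTwo (QInv 4))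
      (by linarith) (by linarith)
    norm_num [div_pow] at hr hlog ⊢
    nlinarith [pow_pos hx0 4]
  · have hE := exp_div_le (p := 5) (n := 2) (q := 12.19) (by norm_num) (by norm_num) (by norm_num)
    have hE' : Real.exp (3.6 * 0.694) ≤ 12.19 := by
      refine le_trans (Real.exp_le_exp.2 ?_) hE
      norm_num
    have hr := expTwo_ratio_four_le hx0 hx1 hE'
    have hr' : expTwo (QInv 4 * x) / expTwo (QInv 4) ≤ 0.579 * x ^ 2 := by
      refine hr.trans ?_
      norm_num [div_pow]
      nlinarith [pow_pos hx0 2]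
    have hlog1 : Real.log (1 + expTwo (QInv 4 * x) / expTwo (QInv 4))
        ≤ Real.log (1 + 0.579 * x ^ 2) := Real.log_le_log (by linarith) (by linarith)
    have hlog2 := log_one_add_le (r := 0.579 * x ^ 2) (by positivity)
    have hv1 : 0.36 ≤ x ^ 2 := by nlinarith
    have hv2 : x ^ 2 ≤ 0.4817 := by nlinarith
    have hv : 0.579 - 0.579 ^ 2 / 2 * x ^ 2 + 0.579 ^ 3 / 3 * (x ^ 2) ^ 2 < 1 / 2 + x ^ 2 / 12 := by
      nlinarith
    have hv3 := mul_lt_mul_of_pos_left hv (pow_pos hx0 2)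
    push_cast
    nlinarith

/-- The range covers `2.15 * 0.6375`, and `0.0115 * (5 - 1.371) > 1/24` makes the Taylor remainder
argument work on it. -/
theorem expTwo_le_poly {v : ℝ} (hv0 : 0 ≤ v) (hv1 : v ≤ 1.371) :
    expTwo v ≤ v ^ 2 / 2 + v ^ 3 / 6 + v ^ 4 / 24 + 0.0115 * v ^ 5 := by
  have := nonneg_of_hasDerivAt_nonneg
    (f := fun t => (1 + t + t ^ 2 / 2 + t ^ 3 / 6 + t ^ 4 / 24 + 0.0115 * t ^ 5) * Real.exp (-t) - 1)
    (f' := fun t => t ^ 4 * (0.0115 * (5 - t) - 1 / 24) * Real.exp (-t)) hv0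
    (fun t _ => (((((((((hasDerivAt_id t).const_add 1).add
        (((hasDerivAt_id t).pow 2).div_const 2)).add
        (((hasDerivAt_id t).pow 3).div_const 6)).add
        (((hasDerivAt_id t).pow 4).div_const 24)).add
        (((hasDerivAt_id t).pow 5).const_mul 0.0115)).mul
        (hasDerivAt_neg t).exp)).sub_const 1).congr_deriv (by simp; ring))
    (fun t ht => mul_nonneg (mul_nonneg (pow_nonneg ht.1.le 4) (by
      have := ht.2; norm_num at hv1 ⊢; linarith)) (Real.exp_pos _).le) (by simp)
  have h1 : Real.exp v * Real.exp (-v) = 1 := by rw [← Real.exp_add]; simp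
  have h2 := mul_nonneg (Real.exp_pos v).le this
  have h3 : Real.exp v * ((1 + v + v ^ 2 / 2 + v ^ 3 / 6 + v ^ 4 / 24 + 0.0115 * v ^ 5)
      * Real.exp (-v) - 1) = (1 + v + v ^ 2 / 2 + v ^ 3 / 6 + v ^ 4 / 24 + 0.0115 * v ^ 5)
      - Real.exp v := by
    linear_combination (1 + v + v ^ 2 / 2 + v ^ 3 / 6 + v ^ 4 / 24 + 0.0115 * v ^ 5) * h1
  rw [h3] at h2
  unfold expTwo
  linarith

theorem QInv_three_le : QInv 3 ≤ 2.15 := by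
  refine QInv_le (by norm_num) (by norm_num) ?_
  have := exp_div_le (p := 43) (n := 20) (q := 8.588) (by norm_num) (by norm_num) (by norm_num)
  norm_num at this
  unfold expTwo
  norm_num
  linarith

theorem le_expTwo_QInv_three : 5.419 ≤ expTwo (QInv 3) := by
  have hE := le_exp_div (p := 58) (n := 27) (q := 8.5673) (by norm_num) (by norm_num)
  norm_num at hE
  have h : 58 / 27 ≤ QInv 3 := by
    refine le_QInv (by norm_num) (by norm_num) ?_
    unfold expTwo
    norm_num
    linarith
  refine le_trans ?_ (expTwo_mono (by norm_num) h)
  unfold expTwo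
  norm_num
  linarith

theorem expTwo_ratio_three_le {y : ℝ} (hy0 : 0 < y) (hy1 : y ≤ 0.6375) :
    expTwo (QInv 3 * y) / expTwo (QInv 3)
      ≤ 0.4266 * y ^ 2 + 0.3058 * y ^ 3 + 0.1644 * y ^ 4 + 0.0977 * y ^ 5 := by
  have hq : 0 < QInv 3 := by linarith [QInv_three_bounds.1]
  have h1 := expTwo_mono (mul_pos hq hy0).le (mul_le_mul_of_nonneg_right QInv_three_le hy0.le)
  have h2 := expTwo_le_poly (v := 2.15 * y) (by positivity) (by linarith)
  have h3 := le_expTwo_QInv_three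
  rw [div_le_iff₀ (by linarith)]
  have h4 : 5.419 * (0.4266 * y ^ 2 + 0.3058 * y ^ 3 + 0.1644 * y ^ 4 + 0.0977 * y ^ 5)
      ≤ expTwo (QInv 3)
        * (0.4266 * y ^ 2 + 0.3058 * y ^ 3 + 0.1644 * y ^ 4 + 0.0977 * y ^ 5) := by
    gcongr
  have p2 := pow_pos hy0 2
  have p3 := pow_pos hy0 3
  have p4 := pow_pos hy0 4
  have p5 := pow_pos hy0 5
  norm_num [mul_pow] at h1 h2 h4 ⊢
  linarith

/-- The choice `y = x` fails for `c` near `3` and `x` near `0.85`. Taking `y = 3x/4` costs some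
relative entropy but lowers the `exp₂` ratio by more. -/
theorem J_three_neg {c x : ℝ} (hc : 2 < c) (hcK : c ≤ 3)
    (hx0 : 0 < x) (hx : 0.99 * beta 3 ≤ (1 - x) / 2) :
    J 3 ((1 - x) / 2) ((1 - 3 / 4 * x) / 2, (1 + 3 / 4 * x) / 2) c < 0 := by
  have hb := le_beta_three.trans hx
  have hx1 : x ≤ 0.85 := by linarith
  set y := 3 / 4 * x with hy
  have hy0 : 0 < y := by positivity
  have hy1 : y ≤ 0.6375 := by linarith
  have hm := mul_J_center_le (K := 3) le_rfl hc (by exact_mod_cast hcK) hx0 (by linarith) hy0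
    (by linarith)
  have hd := deficit_le hx0.le hx1
  have hu := le_three_halves_log_add hy0.le (by linarith)
  have hr := expTwo_ratio_three_le hy0 hy1
  have hq : 0 < QInv 3 := by linarith [QInv_three_bounds.1]
  have hr0 : 0 < expTwo (QInv 3 * y) / expTwo (QInv 3) :=
    div_pos (expTwo_pos (mul_pos hq hy0).ne') (expTwo_pos hq.ne')
  set R := 0.4266 * y ^ 2 + 0.3058 * y ^ 3 + 0.1644 * y ^ 4 + 0.0977 * y ^ 5 with hR
  have hR0 : 0 ≤ R := by positivity
  have hlog1 : Real.log (1 + expTwo (QInv 3 * y) / expTwo (QInv 3)) ≤ Real.log (1 + R) :=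
    Real.log_le_log (by linarith) (by linarith)
  have hlog2 := log_one_add_le hR0
  have hR3 : R ≤ 0.3 := by
    calc R ≤ 0.4266 * 0.6375 ^ 2 + 0.3058 * 0.6375 ^ 3 + 0.1644 * 0.6375 ^ 4
          + 0.0977 * 0.6375 ^ 5 := by rw [hR]; gcongr
      _ ≤ 0.3 := by norm_num
  have hlow : 0.4266 * y ^ 2 + 0.3058 * y ^ 3 ≤ R := by
    rw [hR]
    have := pow_pos hy0 4
    have := pow_pos hy0 5
    linarith
  have hR2 : (0.4266 * y ^ 2 + 0.3058 * y ^ 3) ^ 2 ≤ R ^ 2 := by gcongr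
  -- For `R ≤ 0.3` one has `R²/2 - R³/3 ≥ 0.4 R²`.
  have hlog3 : Real.log (1 + R) ≤ R - 0.4 * (0.4266 * y ^ 2 + 0.3058 * y ^ 3) ^ 2 := by
    have : 0 ≤ R ^ 2 * (0.3 - R) := mul_nonneg (sq_nonneg R) (by linarith)
    nlinarith
  have hxy : x * (Real.log (1 + y) - Real.log (1 - y))
      = 4 / 3 * (y * (Real.log (1 + y) - Real.log (1 - y))) := by rw [hy]; ring
  have hpoly : x ^ 2 + x ^ 4 / 6 + x ^ 6 / 15 + x ^ 8 / 28 + 0.0802 * x ^ 10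
      - (5 / 2 * y ^ 2 + 7 / 12 * y ^ 4 + 3 / 10 * y ^ 6)
      + R - 0.4 * (0.4266 * y ^ 2 + 0.3058 * y ^ 3) ^ 2 < 0 := by
    -- A rounded-up majorant of the polynomial divided by `x²`; negative terms are dropped.
    have hneg : -0.166 + 0.1291 * x + 0.0113 * x ^ 2 + 0.0067 * x ^ 4 + 0.0358 * x ^ 6
        + 0.0803 * x ^ 8 < 0 := by
      have hpow : ∀ n : ℕ, x ^ n ≤ 0.85 ^ n := fun n => pow_le_pow_left₀ hx0.le hx1 n
      have q2 := hpow 2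
      have q4 := hpow 4
      have q6 := hpow 6
      have q8 := hpow 8
      norm_num at hx1 q2 q4 q6 q8 ⊢
      linarith
    have h := mul_neg_of_pos_of_neg (pow_pos hx0 2) hneg
    have p3 := pow_pos hx0 3
    have p4 := pow_pos hx0 4
    have p5 := pow_pos hx0 5
    have p6 := pow_pos hx0 6
    have p8 := pow_pos hx0 8
    have p10 := pow_pos hx0 10
    rw [hR, hy]
    norm_num [mul_pow] at h ⊢
    ring_nf at h ⊢
    linarith [pow_pos hx0 2]
  have hJ : 3 * J 3 ((1 - x) / 2) ((1 - y) / 2, (1 + y) / 2) c < 0 := by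
    push_cast at hm
    linarith
  linarith

/-! ### Every `α` in `(0, 1]` admits some `ζ` with `J < 0`. -/

theorem sub_inv_pos {K : ℕ} (hK : 3 ≤ K) : 0 < 1 / 2 - 1 / (K : ℝ) := by
  have hK' : (3 : ℝ) ≤ K := by exact_mod_cast hK
  have := one_div_le_one_div_of_le (by norm_num) hK'
  linarith

/-- Here `J = (1/K - 1/c) log 2`, so the strict inequality `c < K` is essential. -/
theorem J_half_neg {K : ℕ} {c : ℝ} (hc : 2 < c) (hcK : c < K) :
    J K (1 / 2) (1 / 2, 1 / 2) c < 0 := by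
  have h2 := expTwo_pos (QInv_pos hc).ne'
  have hl := Real.log_two_gt_d9
  have e : (expTwo (QInv c * (1 / 2 + 1 / 2)) + expTwo (QInv c * (1 / 2 - 1 / 2)))
      / (2 * expTwo (QInv c)) = 2⁻¹ := by
    norm_num [expTwo_zero]
    field_simp
  have e2 : J K (1 / 2) (1 / 2, 1 / 2) c = (1 / K - 1 / c) * Real.log 2 := by
    unfold J H
    simp only
    rw [e, show (1 : ℝ) - 1 / 2 = 1 / 2 by norm_num, div_self (by norm_num), Real.log_inv,
      Real.log_one, one_div (2 : ℝ), Real.log_inv]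
    ring
  rw [e2]
  have := one_div_lt_one_div_of_lt (by linarith) hcK
  exact mul_neg_of_neg_of_pos (by linarith) (by linarith)

theorem exists_J_neg_of_le_half {K : ℕ} (hK : 3 ≤ K) {c α : ℝ} (hc : 2 < c) (hcK : c < K)
    (h0 : 0 < α) (h1 : α ≤ 1 / 2) : ∃ ζ : ℝ × ℝ, 0 < ζ.1 ∧ ζ.1 ≤ ζ.2 ∧ J K α ζ c < 0 := by
  have hK' : (3 : ℝ) ≤ K := by exact_mod_cast hK
  rcases h1.eq_or_lt with rfl | h1
  · exact ⟨(1 / 2, 1 / 2), by norm_num, le_rfl, J_half_neg hc hcK⟩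
  have hb := beta_pos K
  rcases lt_or_ge α (0.99 * beta K) with h | h
  · refine ⟨(Real.sqrt (α / ((K : ℝ) - 1)), 1), Real.sqrt_pos.2 (div_pos h0 (by linarith)), ?_,
      (J_sqrt_le hK hc hcK.le h0 (by linarith)).trans_lt ?_⟩
    · refine (Real.sqrt_le_sqrt ?_).trans_eq Real.sqrt_one
      rw [div_le_one (by linarith)]
      linarith
    · refine mul_neg_of_pos_of_neg (mul_pos (sub_inv_pos hK) h0) (Real.log_neg (by positivity) ?_)
      rw [div_lt_one hb]; linarith
  · obtain ⟨x, rfl⟩ : ∃ x, α = (1 - x) / 2 := ⟨1 - 2 * α, by ring⟩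
    have hx0 : 0 < x := by linarith
    have hx1 : x < 1 := by linarith
    rcases lt_or_ge K 6 with h6 | h6
    · interval_cases K
      · exact ⟨_, by simp only; linarith, by simp only; linarith,
          J_three_neg hc (by exact_mod_cast hcK.le) hx0 h⟩
      · exact ⟨_, by simp only; linarith, by simp only; linarith,
          J_diagonal_neg_four hc (by exact_mod_cast hcK.le) hx0 h⟩
      · exact ⟨_, by simp only; linarith, by simp only; linarith,
          J_diagonal_neg_five hc (by exact_mod_cast hcK.le) hx0 h⟩
    · exact ⟨_, by simp only; linarith, by simp only; linarith,
          J_diagonal_neg_of_six_le h6 hc hcK.le hx0 h⟩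

theorem expTwo_neg_le {y : ℝ} (hy : 0 ≤ y) : expTwo (-y) ≤ expTwo y := by
  have := Real.self_le_sinh_iff.2 hy
  rw [Real.sinh_eq] at this
  unfold expTwo
  linarith

theorem expTwo_neg_lt {y : ℝ} (hy : 0 < y) : expTwo (-y) < expTwo y := by
  have := Real.self_lt_sinh_iff.2 hy
  rw [Real.sinh_eq] at this
  unfold expTwo
  linarith

/-- Swapping only changes the sign of `ζ₂ - ζ₁`, and `exp₂(-y) ≤ exp₂(y)` for `y ≥ 0`. -/
theorem J_swap_le {K : ℕ} {c α : ℝ} {ζ : ℝ × ℝ} (hc : 2 < c) (h1 : 0 < ζ.1) (h2 : ζ.1 ≤ ζ.2) :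
    J K (1 - α) (ζ.2, ζ.1) c ≤ J K α ζ c := by
  have hq := QInv_pos hc
  have p1 := expTwo_pos hq.ne'
  have p2 : 0 < expTwo (QInv c * (ζ.2 + ζ.1)) :=
    expTwo_pos (mul_pos hq (by linarith)).ne'
  have h3 : expTwo (QInv c * (ζ.1 - ζ.2)) ≤ expTwo (QInv c * (ζ.2 - ζ.1)) := by
    have := expTwo_neg_le (mul_nonneg hq.le (sub_nonneg.2 h2))
    rwa [← mul_neg, neg_sub] at this
  have h4 := expTwo_nonneg (QInv c * (ζ.1 - ζ.2))
  have hlog : Real.log ((expTwo (QInv c * (ζ.1 + ζ.2)) + expTwo (QInv c * (ζ.1 - ζ.2)))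
        / (2 * expTwo (QInv c))) ≤ Real.log ((expTwo (QInv c * (ζ.2 + ζ.1))
        + expTwo (QInv c * (ζ.2 - ζ.1))) / (2 * expTwo (QInv c))) := by
    rw [add_comm ζ.1]
    refine Real.log_le_log (by positivity) ?_
    gcongr
  have hc' : 0 ≤ 1 / c := one_div_nonneg.2 (by linarith)
  have := mul_le_mul_of_nonneg_left hlog hc'
  unfold J H
  simp only [sub_sub_cancel]
  linarith

/-- For `ζ = (1, τ)` only the logarithmic term survives; at `τ = 0` it is negative because `exp₂(-λ)
< exp₂(λ)`, and continuity allows a small `τ > 0`. -/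
theorem exists_J_one_neg {K : ℕ} {c : ℝ} (hc : 2 < c) :
    ∃ ζ : ℝ × ℝ, 0 < ζ.1 ∧ 0 < ζ.2 ∧ J K 1 ζ c < 0 := by
  have hq := QInv_pos hc
  have p1 := expTwo_pos hq.ne'
  have hcont : ContinuousAt (fun τ : ℝ => Real.log ((expTwo (QInv c * (τ + 1))
      + expTwo (QInv c * (τ - 1))) / (2 * expTwo (QInv c)))) 0 := by
    have hce := continuous_expTwo
    refine ContinuousAt.log (by fun_prop) ?_
    have := expTwo_nonneg (QInv c * (0 - 1))
    rw [zero_add, mul_one]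
    positivity
  have h0 : Real.log ((expTwo (QInv c * (0 + 1))
      + expTwo (QInv c * (0 - 1))) / (2 * expTwo (QInv c))) < 0 := by
    have h := expTwo_neg_lt hq
    have h2 := expTwo_nonneg (-QInv c)
    rw [zero_add, zero_sub, mul_one, mul_neg_one]
    refine Real.log_neg (by positivity) ?_
    rw [div_lt_one (by positivity)]
    linarith
  have hev := (hcont.eventually_lt continuousAt_const h0).filter_mono
    (nhdsWithin_le_nhds (s := Ioi 0))
  obtain ⟨τ, hτ, hτ0⟩ := (hev.and self_mem_nhdsWithin).exists
  refine ⟨(1, τ), one_pos, hτ0, ?_⟩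
  have e : J K 1 (1, τ) c = 1 / c * Real.log ((expTwo (QInv c * (τ + 1))
      + expTwo (QInv c * (τ - 1))) / (2 * expTwo (QInv c))) := by
    unfold J H
    simp
  rw [e]
  exact mul_neg_of_pos_of_neg (one_div_pos.2 (by linarith)) hτ

theorem exists_J_neg {K : ℕ} (hK : 3 ≤ K) {c α : ℝ} (hc : 2 < c) (hcK : c < K)
    (h0 : 0 < α) (h1 : α ≤ 1) : ∃ ζ : ℝ × ℝ, 0 < ζ.1 ∧ 0 < ζ.2 ∧ J K α ζ c < 0 := by
  rcases le_total α (1 / 2) with h | h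
  · obtain ⟨ζ, h2, h3, h4⟩ := exists_J_neg_of_le_half hK hc hcK h0 h
    exact ⟨ζ, h2, h2.trans_le h3, h4⟩
  rcases h1.eq_or_lt with rfl | h1
  · exact exists_J_one_neg hc
  · obtain ⟨ζ, h2, h3, h4⟩ := exists_J_neg_of_le_half hK hc hcK (α := 1 - α) (by linarith)
      (by linarith)
    refine ⟨(ζ.2, ζ.1), h2.trans_le h3, h2, ?_⟩
    have := J_swap_le (K := K) (α := 1 - α) hc h2 h3
    rw [sub_sub_cancel] at this
    exact this.trans_lt h4

/-! ### Continuity, compactness and piecewise constant choices of `ζ`. -/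

theorem continuousAt_J (K : ℕ) {c α : ℝ} {ζ : ℝ × ℝ} (hc : 2 < c) (h1 : 0 < ζ.1) (h2 : 0 < ζ.2) :
    ContinuousAt (fun p : ℝ × ℝ => J K p.1 ζ p.2) (α, c) := by
  have hlog := Real.continuous_mul_log
  have hdiv : ∀ {z : ℝ}, 0 < z → Continuous fun a : ℝ => a * Real.log (a / z) := by
    intro z hz
    have : (fun a : ℝ => a * Real.log (a / z)) = fun a => z * (a / z * Real.log (a / z)) := by
      ext a; field_simp
    rw [this]
    exact continuous_const.mul (hlog.comp (continuous_id.div_const z))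
  have hH : Continuous H := by
    have : H = fun a => -(a * Real.log a) - (1 - a) * Real.log (1 - a) := by
      ext a; unfold H; ring
    rw [this]
    exact hlog.neg.sub (hlog.comp (continuous_const.sub continuous_id))
  have hA : Continuous fun a : ℝ => 1 / (K : ℝ) * H a + a * Real.log (a / ζ.1)
      + (1 - a) * Real.log ((1 - a) / ζ.2) :=
    ((continuous_const.mul hH).add (hdiv h1)).add
      ((hdiv h2).comp (continuous_const.sub continuous_id))
  have hq := continuousAt_QInv hc
  have hqp := QInv_pos hc
  have p1 := expTwo_pos hqp.ne'
  have p2 : 0 < expTwo (QInv c * (ζ.2 + ζ.1)) :=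
    expTwo_pos (mul_pos hqp (by linarith)).ne'
  have p3 := expTwo_nonneg (QInv c * (ζ.2 - ζ.1))
  have hE : ∀ z : ℝ, ContinuousAt (fun d => expTwo (QInv d * z)) c := fun z =>
    continuous_expTwo.continuousAt.comp (hq.mul continuousAt_const)
  have hE1 : ContinuousAt (fun d => expTwo (QInv d)) c :=
    continuous_expTwo.continuousAt.comp hq
  have hB : ContinuousAt (fun d : ℝ => 1 / d * Real.log ((expTwo (QInv d * (ζ.2 + ζ.1))
      + expTwo (QInv d * (ζ.2 - ζ.1))) / (2 * expTwo (QInv d)))) c := by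
    refine ContinuousAt.mul (continuousAt_const.div continuousAt_id (by linarith)) ?_
    refine ContinuousAt.log (((hE _).add (hE _)).div (continuousAt_const.mul hE1)
      (by positivity)) ?_
    positivity
  have hB' := ContinuousAt.comp (f := fun p : ℝ × ℝ => p.2) (x := (α, c)) hB continuousAt_snd
  exact (hA.comp continuous_fst).continuousAt.add hB'

namespace PiecewiseContinuousOn

variable {f g : ℝ → ℝ × ℝ} {a b : ℝ}

theorem of_continuous (hf : Continuous f) : PiecewiseContinuousOn f a b :=
  ⟨⟨∅, fun _ _ _ => hf.continuousWithinAt⟩,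
    fun x _ => ⟨f x, (hf.tendsto x).mono_left nhdsWithin_le_nhds⟩,
    fun x _ => ⟨f x, (hf.tendsto x).mono_left nhdsWithin_le_nhds⟩⟩

theorem update (hf : Continuous f) (p : ℝ) (v : ℝ × ℝ) :
    PiecewiseContinuousOn (Function.update f p v) a b := by
  have key : ∀ x, Function.update f p v =ᶠ[𝓝[≠] x] f := by
    intro x
    have : ∀ᶠ y in 𝓝[≠] x, y ≠ p := by
      by_cases h : x = p
      · subst h; exact self_mem_nhdsWithin
      · exact (eventually_ne_nhds h).filter_mono nhdsWithin_le_nhds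
    filter_upwards [this] with y hy
    exact Function.update_of_ne hy _ _
  refine ⟨⟨{p}, fun x _ hx => ?_⟩, fun x _ => ⟨f x, ?_⟩, fun x _ => ⟨f x, ?_⟩⟩
  · have hx' : x ≠ p := by simpa using hx
    refine ContinuousAt.continuousWithinAt ?_
    rw [continuousAt_update_of_ne hx']
    exact hf.continuousAt
  · exact ((hf.tendsto x).mono_left nhdsWithin_le_nhds).congr'
      ((key x).filter_mono (nhdsWithin_mono _ fun y hy => ne_of_gt hy)).symm
  · exact ((hf.tendsto x).mono_left nhdsWithin_le_nhds).congr'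
      ((key x).filter_mono (nhdsWithin_mono _ fun y hy => ne_of_lt hy)).symm

theorem ite_lt (hf : PiecewiseContinuousOn f a b) (hg : PiecewiseContinuousOn g a b) (t : ℝ) :
    PiecewiseContinuousOn (fun x => if x < t then f x else g x) a b := by
  obtain ⟨⟨F, hF⟩, hf1, hf2⟩ := hf
  obtain ⟨⟨G, hG⟩, hg1, hg2⟩ := hg
  refine ⟨⟨insert t (F ∪ G), fun x hx hxF => ?_⟩, fun x hx => ?_, fun x hx => ?_⟩
  · simp only [Finset.mem_insert, Finset.mem_union, not_or] at hxF
    rcases lt_or_gt_of_ne hxF.1 with h | h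
    · refine (hF x hx hxF.2.1).congr_of_eventuallyEq ?_ (if_pos h)
      filter_upwards [(Iio_mem_nhds h : Iio t ∈ 𝓝 x) |> mem_nhdsWithin_of_mem_nhds] with y hy
      exact if_pos hy
    · refine (hG x hx hxF.2.2).congr_of_eventuallyEq ?_ (if_neg h.not_gt)
      filter_upwards [(Ioi_mem_nhds h : Ioi t ∈ 𝓝 x) |> mem_nhdsWithin_of_mem_nhds] with y hy
      exact if_neg (not_lt.2 (le_of_lt hy))
  · rcases lt_or_ge x t with h | h
    · obtain ⟨l, hl⟩ := hf1 x hx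
      refine ⟨l, hl.congr' ?_⟩
      filter_upwards [(Iio_mem_nhds h : Iio t ∈ 𝓝 x) |> mem_nhdsWithin_of_mem_nhds] with y hy
      exact (if_pos hy).symm
    · obtain ⟨l, hl⟩ := hg1 x hx
      refine ⟨l, hl.congr' ?_⟩
      filter_upwards [self_mem_nhdsWithin] with y hy
      exact (if_neg (not_lt.2 (h.trans (le_of_lt hy)))).symm
  · rcases le_or_gt x t with h | h
    · obtain ⟨l, hl⟩ := hf2 x hx
      refine ⟨l, hl.congr' ?_⟩
      filter_upwards [self_mem_nhdsWithin] with y hy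
      exact (if_pos (lt_of_lt_of_le hy h)).symm
    · obtain ⟨l, hl⟩ := hg2 x hx
      refine ⟨l, hl.congr' ?_⟩
      filter_upwards [(Ioi_mem_nhds h : Ioi t ∈ 𝓝 x) |> mem_nhdsWithin_of_mem_nhds] with y hy
      exact (if_neg (not_lt.2 (le_of_lt hy))).symm

end PiecewiseContinuousOn

/-- A piecewise continuous choice of `ζ` on `[0, 1]`, with `ζ₂ ≥ e`, for which `J ≤ -e` on `s`. -/
def IsWitness (K : ℕ) (c e : ℝ) (s : Set ℝ) (f : ℝ → ℝ × ℝ) : Prop :=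
  PiecewiseContinuousOn f 0 1 ∧ (∀ α ∈ Icc (0 : ℝ) 1, 0 < (f α).1 ∧ e ≤ (f α).2) ∧
    ∀ α ∈ s, J K α (f α) c ≤ -e

theorem exists_local_bound {K : ℕ} (hK : 3 ≤ K) {c α : ℝ} (hc : 2 < c) (hcK : c < K)
    (h0 : 0 < α) (h1 : α ≤ 1) : ∃ (ζ : ℝ × ℝ) (e : ℝ) (U : Set ℝ), 0 < e ∧ 0 < ζ.1 ∧ e ≤ ζ.2 ∧
      IsOpen U ∧ α ∈ U ∧ ∀ᶠ d in 𝓝 c, ∀ a ∈ U, J K a ζ d ≤ -e := by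
  obtain ⟨ζ, hζ1, hζ2, hJ⟩ := exists_J_neg hK hc hcK h0 h1
  set e := min (-J K α ζ c / 2) ζ.2 with he
  have he0 : 0 < e := lt_min (by linarith) hζ2
  have he1 : e ≤ -J K α ζ c / 2 := min_le_left _ _
  have hev : ∀ᶠ p : ℝ × ℝ in 𝓝 (α, c), J K p.1 ζ p.2 < -e :=
    (continuousAt_J K hc hζ1 hζ2).eventually_lt continuousAt_const
      (show J K α ζ c < -e by linarith)
  rw [nhds_prod_eq, eventually_prod_iff] at hev
  obtain ⟨p, hp, q, hq, hpq⟩ := hev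
  obtain ⟨U, hU, hUo, hαU⟩ := eventually_nhds_iff.1 hp
  refine ⟨ζ, e, U, he0, hζ1, min_le_right _ _, hUo, hαU, ?_⟩
  filter_upwards [hq] with d hd a ha
  exact (hpq (hU a ha) hd).le

/-- A Lebesgue number `δ` of the cover by local bounds allows sweeping `[a, 1]` in steps of `δ/2`,
with one constant `ζ` per step. The same `f` serves all `d` near `c`. -/
theorem exists_isWitness {K : ℕ} (hK : 3 ≤ K) {c a : ℝ} (hc : 2 < c) (hcK : c < K)
    (ha : 0 < a) : ∃ (e : ℝ) (f : ℝ → ℝ × ℝ), 0 < e ∧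
      ∀ᶠ d in 𝓝 c, IsWitness K d e (Icc a 1) f := by
  choose! ζ e U he hζ1 hζ2 hUo hmem hev using fun α (h : α ∈ Icc a 1) =>
    exists_local_bound hK hc hcK (ha.trans_le h.1) h.2
  obtain ⟨δ, hδ, hL⟩ := lebesgue_number_lemma_of_metric (s := Icc a 1)
    (c := fun i : Icc a 1 => U i) isCompact_Icc (fun i => hUo i i.2)
    (fun x hx => mem_iUnion.2 ⟨⟨x, hx⟩, hmem x hx⟩)
  have step : ∀ n : ℕ, ∃ (η : ℝ) (f : ℝ → ℝ × ℝ), 0 < η ∧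
      ∀ᶠ d in 𝓝 c, IsWitness K d η (Icc a 1 ∩ Iio (a + n * (δ / 2))) f := by
    intro n
    induction n with
    | zero =>
      refine ⟨1, fun _ => (1, 1), one_pos, Eventually.of_forall fun d =>
        ⟨.of_continuous continuous_const, fun _ _ => ⟨one_pos, le_rfl⟩, fun α hα => ?_⟩⟩
      have h1 := hα.1.1
      have h2 : α < a + (0 : ℕ) * (δ / 2) := hα.2
      simp at h2
      linarith
    | succ n ih =>
      obtain ⟨η, f, hη, hf⟩ := ih
      set t := a + n * (δ / 2) with ht
      have ht' : a + (n + 1 : ℕ) * (δ / 2) = t + δ / 2 := by push_cast; rw [ht]; ring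
      have hta : a ≤ t := by
        have : 0 ≤ (n : ℝ) * (δ / 2) := by positivity
        linarith
      rcases lt_or_ge 1 t with h1 | h1
      · refine ⟨η, f, hη, hf.mono fun d hd => ⟨hd.1, hd.2.1, fun α hα => hd.2.2 α ⟨hα.1, ?_⟩⟩⟩
        exact hα.1.2.trans_lt h1
      · obtain ⟨i, hi⟩ := hL t ⟨hta, h1⟩
        refine ⟨min η (e i), fun x => if x < t then f x else ζ i, lt_min hη (he i i.2), ?_⟩
        filter_upwards [hf, hev i i.2] with d hd hd2
        refine ⟨hd.1.ite_lt (.of_continuous continuous_const) t, fun α hα => ?_, fun α hα => ?_⟩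
        · dsimp only
          split_ifs
          · exact ⟨(hd.2.1 α hα).1, (min_le_left _ _).trans (hd.2.1 α hα).2⟩
          · exact ⟨hζ1 i i.2, (min_le_right _ _).trans (hζ2 i i.2)⟩
        · dsimp only
          split_ifs with h
          · exact (hd.2.2 α ⟨hα.1, h⟩).trans (neg_le_neg (min_le_left _ _))
          · refine (hd2 α (hi ?_)).trans (neg_le_neg (min_le_right _ _))
            have h2 : α < a + (n + 1 : ℕ) * (δ / 2) := hα.2
            rw [ht'] at h2
            rw [Metric.mem_ball, Real.dist_eq, abs_of_nonneg (by linarith)]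
            linarith
  obtain ⟨n, hn⟩ := exists_nat_gt ((1 - a) / (δ / 2))
  rw [div_lt_iff₀ (by positivity)] at hn
  obtain ⟨η, f, hη, hf⟩ := step n
  refine ⟨η, f, hη, hf.mono fun d hd => ⟨hd.1, hd.2.1, fun α hα => hd.2.2 α ⟨hα, ?_⟩⟩⟩
  have := hα.2
  simp only [mem_Iio]
  linarith

/-! ### Gluing the two ranges and selecting the bound continuously in `c`. -/

/-- The positive constants `e` that serve both as `ε_K(c)` and as the lower bound for `ζ₂`. -/
def admissible (K : ℕ) (c : ℝ) : Set ℝ :=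
  {e | 0 < e ∧ ∃ f, IsWitness K c e (Icc (beta K / 2) 1) f ∧
    ∀ α ∈ Ioo 0 (0.99 * beta K),
      J K α (f α) c ≤ (1 / 2 - 1 / (K : ℝ)) * α * Real.log (α / beta K)}

/-- Lowering `e` to a positive value keeps the same witness. -/
theorem convex_admissible (K : ℕ) (c : ℝ) : Convex ℝ (admissible K c) := by
  refine OrdConnected.convex ⟨fun x hx y hy z hz => ⟨hx.1.trans_le hz.1, ?_⟩⟩
  obtain ⟨-, f, hf, hf2⟩ := hy
  exact ⟨f, ⟨hf.1, fun α hα => ⟨(hf.2.1 α hα).1, hz.2.trans (hf.2.1 α hα).2⟩,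
    fun α hα => (hf.2.2 α hα).trans (neg_le_neg hz.2)⟩, hf2⟩

theorem exists_eventually_mem_admissible {K : ℕ} (hK : 3 ≤ K) {c : ℝ} (hc : 2 < c)
    (hcK : c < K) : ∃ e, ∀ᶠ d in 𝓝 c, e ∈ admissible K d := by
  have hK' : (3 : ℝ) ≤ K := by exact_mod_cast hK
  have hk : (0 : ℝ) < (K : ℝ) - 1 := by linarith
  have hb := beta_pos K
  have hs := sub_inv_pos hK
  obtain ⟨e, f, he, hf⟩ := exists_isWitness hK hc hcK (a := beta K / 2) (by positivity)
  set t := 0.99 * beta K with ht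
  -- The square root vanishes at `α = 0`, where `ζ₁` must still be positive.
  set u : ℝ → ℝ × ℝ := Function.update (fun α => (Real.sqrt (α / ((K : ℝ) - 1)), 1)) 0 (1, 1)
    with hu
  have hupc : PiecewiseContinuousOn u 0 1 := .update (by fun_prop) _ _
  have hlog : Real.log 0.99 < 0 := Real.log_neg (by norm_num) (by norm_num)
  -- On `[β_K/2, 0.99 β_K)` the small-`α` bound is at most `-e1`.
  set e1 := -((1 / 2 - 1 / (K : ℝ)) * (beta K / 2) * Real.log 0.99) with he1
  have he1p : 0 < e1 := by
    have := mul_neg_of_pos_of_neg (mul_pos hs (half_pos hb)) hlog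
    linarith
  have hup : ∀ α, 0 < α → u α = (Real.sqrt (α / ((K : ℝ) - 1)), 1) := fun α hα =>
    Function.update_of_ne hα.ne' _ _
  refine ⟨min e (min e1 1), ?_⟩
  filter_upwards [hf, Ioo_mem_nhds hc hcK] with d hd hdK
  have hJ : ∀ α, 0 < α → α < t →
      J K α (u α) d ≤ (1 / 2 - 1 / (K : ℝ)) * α * Real.log (α / beta K) := by
    intro α h0 h1
    rw [hup α h0]
    exact J_sqrt_le hK hdK.1 hdK.2.le h0 (by linarith)
  refine ⟨lt_min he (lt_min he1p one_pos), fun x => if x < t then u x else f x,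
    ⟨hupc.ite_lt hd.1 t, fun α hα => ?_, fun α hα => ?_⟩, fun α hα => ?_⟩
  · dsimp only
    split_ifs
    · rcases hα.1.eq_or_lt with h0 | h0
      · rw [← h0, hu, Function.update_self]
        exact ⟨one_pos, (min_le_right _ _).trans (min_le_right _ _)⟩
      · rw [hup α h0]
        exact ⟨Real.sqrt_pos.2 (div_pos h0 hk), (min_le_right _ _).trans (min_le_right _ _)⟩
    · exact ⟨(hd.2.1 α hα).1, (min_le_left _ _).trans (hd.2.1 α hα).2⟩
  · dsimp only
    split_ifs with h
    · have h0 : 0 < α := (half_pos hb).trans_le hα.1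
      refine (hJ α h0 h).trans ?_
      have h1 : Real.log (α / beta K) ≤ Real.log 0.99 := by
        refine Real.log_le_log (by positivity) ?_
        rw [div_le_iff₀ hb]; exact h.le
      have h2 : (1 / 2 - 1 / (K : ℝ)) * α * Real.log (α / beta K)
          ≤ (1 / 2 - 1 / (K : ℝ)) * α * Real.log 0.99 :=
        mul_le_mul_of_nonneg_left h1 (mul_pos hs h0).le
      have h3 : (1 / 2 - 1 / (K : ℝ)) * α * Real.log 0.99
          ≤ (1 / 2 - 1 / (K : ℝ)) * (beta K / 2) * Real.log 0.99 :=
        mul_le_mul_of_nonpos_right (mul_le_mul_of_nonneg_left hα.1 hs.le) hlog.le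
      have h4 : min e (min e1 1) ≤ e1 := (min_le_right _ _).trans (min_le_left _ _)
      linarith
    · exact (hd.2.2 α hα).trans (neg_le_neg (min_le_left _ _))
  · have h : α < t := hα.2
    simp only [if_pos h]
    exact hJ α hα.1 hα.2

end XorGame

theorem proposition4p11 (K : ℕ) (hK : 3 ≤ K) :
    ∃ (ε ζlow : ℝ → ℝ) (ζ : ℝ → ℝ → ℝ × ℝ),
      ContinuousOn ε (Set.Ioo 2 (K : ℝ)) ∧
      ContinuousOn ζlow (Set.Ioo 2 (K : ℝ)) ∧
      (∀ c ∈ Set.Ioo 2 (K : ℝ), 0 < ε c ∧ 0 < ζlow c) ∧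
      ∀ c ∈ Set.Ioo 2 (K : ℝ),
        XorGame.PiecewiseContinuousOn (ζ c) 0 1 ∧
        (∀ α ∈ Set.Icc (0 : ℝ) 1, 0 < (ζ c α).1 ∧ ζlow c ≤ (ζ c α).2) ∧
        (∀ α ∈ Set.Ioo 0 (0.99 * XorGame.beta K),
          XorGame.J K α (ζ c α) c
            ≤ (1 / 2 - 1 / (K : ℝ)) * α * Real.log (α / XorGame.beta K)) ∧
        (∀ α ∈ Set.Icc (XorGame.beta K / 2) 1,
          XorGame.J K α (ζ c α) c ≤ -ε c) := by
  -- Partition of unity: constants admissible near each `c` combine, by convexity, into one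
  -- continuous admissible function, used for both bounds.
  obtain ⟨g, hg⟩ := exists_continuous_forall_mem_convex_of_local_const
    (X := Set.Ioo 2 (K : ℝ)) (t := fun c => XorGame.admissible K c)
    (fun c => XorGame.convex_admissible K c) (fun c => by
      obtain ⟨e, he⟩ := XorGame.exists_eventually_mem_admissible hK c.2.1 c.2.2
      exact ⟨e, continuousAt_subtype_val.eventually he⟩)
  set ε : ℝ → ℝ := fun c => if h : c ∈ Set.Ioo 2 (K : ℝ) then g ⟨c, h⟩ else 1 with hε
  have hεg : ∀ (c : ℝ) (h : c ∈ Set.Ioo 2 (K : ℝ)), ε c = g ⟨c, h⟩ := fun c h => dif_pos h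
  have hεc : ContinuousOn ε (Set.Ioo 2 (K : ℝ)) := by
    rw [continuousOn_iff_continuous_domRestrict]
    convert g.continuous using 1
    ext c
    exact hεg c c.2
  have hmem : ∀ c ∈ Set.Ioo 2 (K : ℝ), ε c ∈ XorGame.admissible K c := fun c h => by
    rw [hεg c h]; exact hg ⟨c, h⟩
  choose! ζ hζ using fun c h => (hmem c h).2
  exact ⟨ε, ε, ζ, hεc, hεc, fun c h => ⟨(hmem c h).1, (hmem c h).1⟩, fun c h =>
    ⟨(hζ c h).1.1, (hζ c h).1.2.1, (hζ c h).2, (hζ c h).1.2.2⟩⟩
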